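/- **Setting.** Let $k\ge 1$ and let $\boldsymbol\mu=(\mu^{(0)},\dots,\mu^{(k-1)})$ be a tuple of (possibly empty) skew shapes with $n\ge 1$ cells in total, drawn in the French convention. Let $\mathrm{SYT}(\boldsymbol\mu)$ be the set of bijective fillings of these cells by $1,\dots,n$ that increase along the rows and up the columns of each shape. The content of a cell is $c(x)=\text{column}-\text{row}$, and the shifted content of a cell $x$ of $\mu^{(i)}$ is $\tilde c(x)=k\,c(x)+i$. The content reading word $w(T)$ lists the entries of $T$ by increasing shifted content, reading each diagonal from southwest to northeast. Put $$\mathrm{dInv}(T)=\{(x,y): k>\tilde c(y)-\tilde c(x)>0,\ T(x)>T(y)\},\qquad \mathrm{dinv}(T)=|\mathrm{dInv}(T)|,$$ and let $\mathrm{Inv}(T)$ be the set of pairs of cells $(x,y)$ such that $x$ is read before $y$ and $T(x)>T(y)$ (the ordinary inversions of $w(T)$), with $\mathrm{inv}(T)=|\mathrm{Inv}(T)|$. Here $(1,n)$ denotes the pair (first cell read, last cell read). For $1<i<n$ and a permutation $w$ of $1,\dots,n$: if $i$ lies between $i-1$ and $i+1$ in $w$, then $d_i(w)=\tilde d_i(w)=w$.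 Otherwise $d_i$ interchanges $i$ and whichever of $i\pm1$ is further away from $i$, and $\tilde d_i$ cyclically rotates $i-1,i,i+1$ in their positions so that $i$ lies on the other side of $i-1$ and $i+1$. For $T\in\mathrm{SYT}(\boldsymbol\mu)$, $D_i(T)$ is the tableau whose content reading word is $\tilde d_i(w(T))$ if the shifted contents of the cells containing $i-1,i,i+1$ pairwise differ by at most $k$, and $d_i(w(T))$ otherwise. Let $Q_{\sigma(T)}$ be the fundamental quasisymmetric function $\sum x_{i_1}\cdots x_{i_n}$ over $i_1\le\dots\le i_n$ with $i_j<i_{j+1}$ whenever $j+1$ is left of $j$ in $w(T)$. An $n$-ribbon $\nu$ is a connected skew shape with $n$ cells and without $2\times 2$ block, taken up to translation; label its cells $1,\dots,n$ by increasing content, let $\mathrm{Des}(\nu)$ be the set of $i$ such that cell $i+1$ lies south of cell $i$, let $\mathrm{maj}(\nu)=\sum_{i\in\mathrm{Des}(\nu)}i$, and let $s_\nu$ be its skew Schur function. **Theorem.** Let $[U]$ be an equivalence class of $\mathrm{SYT}(\boldsymbol\mu)$ under the $D_i$ such that $D_i(T)=\tilde d_i(T)$ for all $T\in[U]$ and all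 $1<i<n$. Then $$\sum_{T\in[U]}Q_{\sigma(T)}(x)=\sum_{\substack{\nu\text{ an }n\text{-ribbon}\\ \mathrm{maj}(\nu)=\mathrm{inv}(U)\\ n-1\in\mathrm{Des}(\nu)\Leftrightarrow(1,n)\in\mathrm{Inv}(U)}}s_\nu .$$ In particular, if the diagonal inversions of $U$ are the usual inversions of its reading word, $\mathrm{dInv}(U)=\mathrm{Inv}(U)$ (as is always the case when every shape is a single unskewed box), then $$\sum_{T\in[U]}Q_{\sigma(T)}(x)=\sum_{\substack{\nu\text{ an }n\text{-ribbon}\\ \mathrm{maj}(\nu)=\mathrm{dinv}(U)\\ n-1\in\mathrm{Des}(\nu)\Leftrightarrow(1,n)\in\mathrm{dInv}(U)}}s_\nu .$$ -/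

import Mathlib

noncomputable section

namespace TwistedLLT

/-! ### Skew shapes, tuples of shapes, standard tuples of tableaux

A cell `(r, c)` lies in row `r` and column `c` (both counted from `0`), rows being numbered from
south to north (French convention) and columns from west to east. -/

/-- A skew diagram `outer / inner`. -/
structure SkewShape where
  outer : YoungDiagram
  inner : YoungDiagram
  le : inner ≤ outer

/-- The set of cells of a skew diagram. -/
def SkewShape.cells (s : SkewShape) : Finset (ℕ × ℕ) := s.outer.cells \ s.inner.cells

/-- The content of a cell: column index minus row index. -/
def content (x : ℕ × ℕ) : ℤ := (x.2 : ℤ) - (x.1 : ℤ)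

/-- The cells of a `k`-tuple of skew shapes: pairs of an index `i` and a cell of `μ i`. -/
def Cell {k : ℕ} (μ : Fin k → SkewShape) : Type :=
  {x : Fin k × (ℕ × ℕ) // x.2 ∈ (μ x.1).cells}

/-- The index of the shape in which a cell lies. -/
def Cell.idx {k : ℕ} {μ : Fin k → SkewShape} (x : Cell μ) : Fin k := x.1.1

/-- The row of a cell. -/
def Cell.row {k : ℕ} {μ : Fin k → SkewShape} (x : Cell μ) : ℕ := x.1.2.1

/-- The column of a cell. -/
def Cell.col {k : ℕ} {μ : Fin k → SkewShape} (x : Cell μ) : ℕ := x.1.2.2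

/-- The shifted content `k * c(x) + i` of a cell `x` of the `i`-th shape. -/
def Cell.shiftedContent {k : ℕ} {μ : Fin k → SkewShape} (x : Cell μ) : ℤ :=
  (k : ℤ) * content x.1.2 + (x.idx : ℕ)

instance instFiniteCell {k : ℕ} (μ : Fin k → SkewShape) : Finite (Cell μ) := by
  refine Set.Finite.to_subtype
    (s := {x : Fin k × (ℕ × ℕ) | x.2 ∈ (μ x.1).cells}) ?_
  refine ((Set.finite_univ (α := Fin k)).prod
    (Set.finite_iUnion fun i => ((μ i).cells.finite_toSet))).subset ?_
  rintro ⟨i, c⟩ h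
  exact ⟨Set.mem_univ _, Set.mem_iUnion.2 ⟨i, h⟩⟩

instance instFintypeCell {k : ℕ} (μ : Fin k → SkewShape) : Fintype (Cell μ) := Fintype.ofFinite _

/-- The position of a cell in the content reading order: by shifted content, and along a diagonal
from southwest to northeast. -/
def Cell.readingKey {k : ℕ} {μ : Fin k → SkewShape} (x : Cell μ) : ℤ ×ₗ ℕ :=
  toLex (x.shiftedContent, x.row)

theorem Cell.readingKey_injective {k : ℕ} {μ : Fin k → SkewShape} :
    Function.Injective (Cell.readingKey (μ := μ)) := by
  rintro ⟨⟨i, r, c⟩, hx⟩ ⟨⟨j, r', c'⟩, hy⟩ h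
  have h1 : (k : ℤ) * ((c : ℤ) - r) + (i : ℕ) = (k : ℤ) * ((c' : ℤ) - r') + (j : ℕ) :=
    congrArg (fun z => (ofLex z).1) h
  have h2 : r = r' := congrArg (fun z => (ofLex z).2) h
  have hk : (0 : ℤ) < k := by have := i.2; omega
  have hi : ((i : ℕ) : ℤ) < k := by exact_mod_cast i.2
  have hj : ((j : ℕ) : ℤ) < k := by exact_mod_cast j.2
  have e1 : (((k : ℤ) * ((c : ℤ) - r) + (i : ℕ)) / k) = (c : ℤ) - r := by
    rw [Int.mul_add_ediv_left _ _ hk.ne', Int.ediv_eq_zero_of_lt (by positivity) hi, add_zero]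
  have e2 : (((k : ℤ) * ((c' : ℤ) - r') + (j : ℕ)) / k) = (c' : ℤ) - r' := by
    rw [Int.mul_add_ediv_left _ _ hk.ne', Int.ediv_eq_zero_of_lt (by positivity) hj, add_zero]
  have h3 : (c : ℤ) - r = (c' : ℤ) - r' := by rw [← e1, ← e2, h1]
  have h4 : i = j := by
    apply Fin.ext
    rw [h3] at h1
    omega
  subst h2 h4
  have h5 : c = c' := by omega
  subst h5
  rfl

/-- The cells of a tuple of shapes, linearly ordered by the content reading order. -/
instance instLinearOrderCell {k : ℕ} (μ : Fin k → SkewShape) : LinearOrder (Cell μ) :=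
  LinearOrder.lift' Cell.readingKey Cell.readingKey_injective

/-- The number of cells of a tuple of shapes. -/
def size {k : ℕ} (μ : Fin k → SkewShape) : ℕ := Fintype.card (Cell μ)

/-- Standard tuples of tableaux of shape `μ`: bijective fillings by `1, …, n` of the cells of
all the shapes together, increasing along every row and every column of each shape. -/
@[ext]
structure SYT {k : ℕ} (μ : Fin k → SkewShape) where
  entry : Cell μ → ℕ
  bijOn : Set.BijOn entry Set.univ (Set.Icc 1 (size μ))
  row_lt : ∀ x y : Cell μ, x.idx = y.idx → x.row = y.row → x.col < y.col → entry x < entry y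
  col_lt : ∀ x y : Cell μ, x.idx = y.idx → x.col = y.col → x.row < y.row → entry x < entry y

instance instFiniteSYT {k : ℕ} (μ : Fin k → SkewShape) : Finite (SYT μ) := by
  refine Finite.of_injective
    (fun T : SYT μ => fun x : Cell μ =>
      (⟨T.entry x, T.bijOn.mapsTo (Set.mem_univ x)⟩ : Set.Icc 1 (size μ))) ?_
  intro T T' h
  ext x
  exact congrArg Subtype.val (congrFun h x)

instance instFintypeSYT {k : ℕ} (μ : Fin k → SkewShape) : Fintype (SYT μ) := Fintype.ofFinite _

/-- The content reading word. -/
def SYT.word {k : ℕ} {μ : Fin k → SkewShape} (T : SYT μ) : List ℕ :=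
  ((Finset.univ : Finset (Cell μ)).sort (· ≤ ·)).map T.entry

/-- The set of diagonal inversions. -/
def SYT.dInv {k : ℕ} {μ : Fin k → SkewShape} (T : SYT μ) : Set (Cell μ × Cell μ) :=
  {p | p.2.shiftedContent - p.1.shiftedContent < (k : ℤ) ∧
    0 < p.2.shiftedContent - p.1.shiftedContent ∧ T.entry p.2 < T.entry p.1}

/-- The diagonal inversion number. -/
def SYT.dinv {k : ℕ} {μ : Fin k → SkewShape} (T : SYT μ) : ℕ := T.dInv.ncard

/-- The set of inversions of the content reading word, as pairs of cells: the first cell is read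
before the second one and has the larger entry. -/
def SYT.wordInv {k : ℕ} {μ : Fin k → SkewShape} (T : SYT μ) : Set (Cell μ × Cell μ) :=
  {p | p.1 < p.2 ∧ T.entry p.2 < T.entry p.1}

/-- The number of inversions of the content reading word. -/
def SYT.winv {k : ℕ} {μ : Fin k → SkewShape} (T : SYT μ) : ℕ := T.wordInv.ncard

/-- `(1, n)` belongs to a set `P` of pairs of cells, the cells being numbered `1, …, n` in the
content reading order: the pair of the first and the last cell is in `P`. -/
def FirstLastMem {k : ℕ} {μ : Fin k → SkewShape} (P : Set (Cell μ × Cell μ)) : Prop :=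
  ∃ x y : Cell μ, IsBot x ∧ IsTop y ∧ (x, y) ∈ P

/-! ### Dual equivalence involutions on words

The functions below are meant for words `w` that are permutations of `1, …, n` and for
`1 < i < n`; `w.idxOf a` is the position of the letter `a` in `w`. -/

/-- `i` lies between `i - 1` and `i + 1` in `w`. -/
def LiesBetween (i : ℕ) (w : List ℕ) : Prop :=
  (w.idxOf (i - 1) < w.idxOf i ∧ w.idxOf i < w.idxOf (i + 1)) ∨
    (w.idxOf (i + 1) < w.idxOf i ∧ w.idxOf i < w.idxOf (i - 1))

/-- Whichever of `i - 1`, `i + 1` is further away from `i` in `w`. -/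
def farther (i : ℕ) (w : List ℕ) : ℕ :=
  if Nat.dist (w.idxOf i) (w.idxOf (i + 1)) < Nat.dist (w.idxOf i) (w.idxOf (i - 1))
  then i - 1 else i + 1

/-- The other one of `i - 1`, `i + 1`. -/
def nearer (i : ℕ) (w : List ℕ) : ℕ :=
  if Nat.dist (w.idxOf i) (w.idxOf (i + 1)) < Nat.dist (w.idxOf i) (w.idxOf (i - 1))
  then i + 1 else i - 1

open Classical in
/-- The elementary dual equivalence involution `d_i`: it fixes `w` if `i` lies between `i - 1` and
`i + 1`, and otherwise it interchanges `i` and whichever of `i ± 1` is further away from `i`. -/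
def dualMove (i : ℕ) (w : List ℕ) : List ℕ :=
  if LiesBetween i w then w
  else w.map fun a => if a = i then farther i w else if a = farther i w then i else a

open Classical in
/-- The elementary twisted dual equivalence involution: it fixes `w` if `i` lies between `i - 1`
and `i + 1`, and otherwise it cyclically rotates `i - 1, i, i + 1` so that `i` lies on the other
side of `i - 1` and `i + 1`. So the outer position that held the letter further away from `i` now
holds `i`, the position that held `i` takes the letter of its neighbour, and the middle
position takes the remaining letter. -/
def twistedMove (i : ℕ) (w : List ℕ) : List ℕ :=
  if LiesBetween i w then w
  else w.map fun a =>
    if a = i then nearer i w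
    else if a = nearer i w then farther i w
    else if a = farther i w then i
    else a

/-! ### The involutions `D_i` and their equivalence classes -/

/-- `dist(i - 1, i, i + 1) ≤ k`: the shifted contents of the cells that hold these three entries
pairwise differ by at most `k`. -/
def DistLE {k : ℕ} {μ : Fin k → SkewShape} (i : ℕ) (T : SYT μ) : Prop :=
  ∀ x y : Cell μ, T.entry x ∈ ({i - 1, i, i + 1} : Set ℕ) →
    T.entry y ∈ ({i - 1, i, i + 1} : Set ℕ) →
    y.shiftedContent - x.shiftedContent ≤ (k : ℤ)

open Classical in
/-- The content reading word of `D_i(T)`. -/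
def moveWord {k : ℕ} {μ : Fin k → SkewShape} (i : ℕ) (T : SYT μ) : List ℕ :=
  if DistLE i T then twistedMove i T.word else dualMove i T.word

/-- `T' = D_i(T)` for some `1 < i < n`. -/
def Step {k : ℕ} {μ : Fin k → SkewShape} (T T' : SYT μ) : Prop :=
  ∃ i : ℕ, 1 < i ∧ i < size μ ∧ T'.word = moveWord i T

/-- The equivalence relation on `SYT μ` generated by the `D_i`. -/
def Equivalent {k : ℕ} {μ : Fin k → SkewShape} (T T' : SYT μ) : Prop :=
  Relation.EqvGen Step T T'

/-! ### Quasisymmetric functions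

Formal power series in `x_1, x_2, …` with integer coefficients. -/

/-- The fundamental quasisymmetric function of degree `n` with descent set `D`: the sum of
`x_{i_1} ⋯ x_{i_n}` over all `i_1 ≤ ⋯ ≤ i_n` with `i_j < i_{j+1}` whenever `j ∈ D`. -/
def fundamental (n : ℕ) (D : Finset ℕ) : MvPowerSeries ℕ+ ℤ := fun m =>
  (Set.ncard {f : Fin n → ℕ+ | Monotone f ∧
    (∀ (j : ℕ) (hj : j + 1 < n), j + 1 ∈ D → f ⟨j, Nat.lt_of_succ_lt hj⟩ < f ⟨j + 1, hj⟩) ∧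
    ∑ j, Finsupp.single (f j) 1 = m} : ℤ)

/-- The positions of the `-1`s in the descent signature of a permutation `w` of `1, …, n`: those
`1 ≤ i ≤ n - 1` for which `i + 1` appears to the left of `i` in `w`. -/
def signatureDes (n : ℕ) (w : List ℕ) : Finset ℕ :=
  (Finset.Icc 1 (n - 1)).filter fun i => w.idxOf (i + 1) < w.idxOf i

open Classical in
/-- The quasisymmetric generating function of the equivalence class of `U`. -/
def classSeries {k : ℕ} {μ : Fin k → SkewShape} (U : SYT μ) : MvPowerSeries ℕ+ ℤ :=
  ∑ T ∈ Finset.univ.filter (fun T : SYT μ => Equivalent U T),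
    fundamental (size μ) (signatureDes (size μ) T.word)

/-! ### Ribbons and their Schur functions -/

/-- Semistandard fillings of a diagram. -/
def IsSSYT (ν : Finset (ℕ × ℕ)) (T : ν → ℕ+) : Prop :=
  (∀ x y : ν, x.1.1 = y.1.1 → x.1.2 ≤ y.1.2 → T x ≤ T y) ∧
    (∀ x y : ν, x.1.2 = y.1.2 → x.1.1 < y.1.1 → T x < T y)

/-- The (skew) Schur function of a diagram: the sum of `x^T` over its semistandard fillings. -/
def schur (ν : Finset (ℕ × ℕ)) : MvPowerSeries ℕ+ ℤ := fun m =>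
  (Set.ncard {T : ν → ℕ+ | IsSSYT ν T ∧ ∑ x, Finsupp.single (T x) 1 = m} : ℤ)

/-- Two cells share an edge. -/
def EdgeAdj (x y : ℕ × ℕ) : Prop :=
  (x.1 = y.1 ∧ (x.2 + 1 = y.2 ∨ y.2 + 1 = x.2)) ∨ (x.2 = y.2 ∧ (x.1 + 1 = y.1 ∨ y.1 + 1 = x.1))

/-- A ribbon: a connected skew diagram that contains no `2 × 2` block of cells. -/
structure IsRibbon (ν : Finset (ℕ × ℕ)) : Prop where
  skew : ∃ s : SkewShape, s.cells = ν
  connected : ∀ x ∈ ν, ∀ y ∈ ν, Relation.ReflTransGen (fun a b => b ∈ ν ∧ EdgeAdj a b) x y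
  no_block : ∀ r c : ℕ,
    ¬ ((r, c) ∈ ν ∧ (r, c + 1) ∈ ν ∧ (r + 1, c) ∈ ν ∧ (r + 1, c + 1) ∈ ν)

/-- The ribbon is translated so that it touches both the first row and the first column; every
translation class of nonempty diagrams has exactly one such member. -/
def IsNormalized (ν : Finset (ℕ × ℕ)) : Prop := (∃ c, (0, c) ∈ ν) ∧ (∃ r, (r, 0) ∈ ν)

open Classical in
/-- The `n`-ribbons (`n ≥ 1`), one for each class under translation. -/
def ribbons (n : ℕ) : Finset (Finset (ℕ × ℕ)) :=
  (Finset.range n ×ˢ Finset.range n).powerset.filter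
    fun ν => IsRibbon ν ∧ IsNormalized ν ∧ ν.card = n

theorem IsRibbon.row_lt_card {ν : Finset (ℕ × ℕ)} (h : IsRibbon ν) (hn : ∃ c, (0, c) ∈ ν)
    {x : ℕ × ℕ} (hx : x ∈ ν) : x.1 < ν.card := by
  obtain ⟨c, hc⟩ := hn
  have key : ∀ y, Relation.ReflTransGen (fun a b => b ∈ ν ∧ EdgeAdj a b) (0, c) y →
      ∀ r ≤ y.1, ∃ z ∈ ν, z.1 = r := by
    intro y hy
    induction hy with
    | refl => intro r hr; exact ⟨_, hc, by simp at hr; simp [hr]⟩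
    | tail _ hbc ih =>
      rename_i b d _
      intro r hr
      by_cases hrd : r = d.1
      · exact ⟨d, hbc.1, hrd.symm⟩
      · apply ih
        rcases hbc.2 with h | h <;> omega
  have hsub : Finset.range (x.1 + 1) ⊆ ν.image Prod.fst := by
    intro r hr
    obtain ⟨z, hz, hzr⟩ := key x (h.connected _ hc _ hx) r (by simp at hr; omega)
    exact Finset.mem_image.2 ⟨z, hz, hzr⟩
  have := (Finset.card_le_card hsub).trans Finset.card_image_le
  simp at this
  omega

theorem IsRibbon.col_lt_card {ν : Finset (ℕ × ℕ)} (h : IsRibbon ν) (hn : ∃ r, (r, 0) ∈ ν)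
    {x : ℕ × ℕ} (hx : x ∈ ν) : x.2 < ν.card := by
  obtain ⟨c, hc⟩ := hn
  have key : ∀ y, Relation.ReflTransGen (fun a b => b ∈ ν ∧ EdgeAdj a b) (c, 0) y →
      ∀ r ≤ y.2, ∃ z ∈ ν, z.2 = r := by
    intro y hy
    induction hy with
    | refl => intro r hr; exact ⟨_, hc, by simp at hr; simp [hr]⟩
    | tail _ hbc ih =>
      rename_i b d _
      intro r hr
      by_cases hrd : r = d.2
      · exact ⟨d, hbc.1, hrd.symm⟩
      · apply ih
        rcases hbc.2 with h | h <;> omega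
  have hsub : Finset.range (x.2 + 1) ⊆ ν.image Prod.snd := by
    intro r hr
    obtain ⟨z, hz, hzr⟩ := key x (h.connected _ hc _ hx) r (by simp at hr; omega)
    exact Finset.mem_image.2 ⟨z, hz, hzr⟩
  have := (Finset.card_le_card hsub).trans Finset.card_image_le
  simp at this
  omega

/-- The bounding box in the definition of `ribbons` excludes nothing. -/
theorem mem_ribbons {n : ℕ} {ν : Finset (ℕ × ℕ)} :
    ν ∈ ribbons n ↔ IsRibbon ν ∧ IsNormalized ν ∧ ν.card = n := by
  classical
  unfold ribbons
  rw [Finset.mem_filter, and_iff_right_iff_imp]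
  rintro ⟨h, hn, rfl⟩
  rw [Finset.mem_powerset]
  intro x hx
  simp only [Finset.mem_product, Finset.mem_range]
  exact ⟨h.row_lt_card hn.1 hx, h.col_lt_card hn.2 hx⟩

/-- The label of a cell `x` of a ribbon when its cells are labelled `1, …, n` in increasing order
of content. -/
def ribbonLabel (ν : Finset (ℕ × ℕ)) (x : ℕ × ℕ) : ℕ :=
  (ν.filter fun y => content y ≤ content x).card

open Classical in
/-- The descent set of a ribbon: the `i` such that the cell labelled `i + 1` lies south of the cell
labelled `i`. -/
def ribbonDes (ν : Finset (ℕ × ℕ)) : Finset ℕ :=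
  (Finset.Icc 1 (ν.card - 1)).filter fun i =>
    ∃ x ∈ ν, ∃ y ∈ ν, ribbonLabel ν x = i ∧ ribbonLabel ν y = i + 1 ∧ y.2 = x.2 ∧ y.1 < x.1

/-- The major index of a ribbon. -/
def ribbonMaj (ν : Finset (ℕ × ℕ)) : ℕ := ∑ i ∈ ribbonDes ν, i

open Classical in
/-- The sum of the ribbon Schur functions `s_ν` over the `n`-ribbons `ν` with `maj(ν) = j` and
`n - 1 ∈ Des(ν) ↔ P`. -/
def ribbonSum (n j : ℕ) (P : Prop) : MvPowerSeries ℕ+ ℤ :=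
  ∑ ν ∈ (ribbons n).filter (fun ν => ribbonMaj ν = j ∧ (n - 1 ∈ ribbonDes ν ↔ P)), schur ν

end TwistedLLT

end

noncomputable section

namespace TwistedLLT

/-! Replace each tableau T by the inverse σ of its reading word, which sends an entry to the
position of its cell (`positionPerm`). A twisted move at i then only touches the three adjacent
letters σ(i-1), σ(i), σ(i+1): it does nothing if the median letter is in the middle, and otherwise
the median letter jumps over the two others. These jumps bac ↔ acb and bca ↔ cab (a < b < c)
generate the forgotten equivalence. When every move on the class is twisted, the twisted result is
always again a tableau (`exists_word_eq_moveWord`), so [U] corresponds to a full forgotten class of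
permutations (`exists_equivalent_of_forgotten`).

A jump preserves the number of inversions, and also the relative order of the smallest and the
largest letter, since the median letter is neither. The combinatorial core, `SameClass.forgotten`,
is that these two invariants are complete. By induction on the length, after a reversal if
necessary, the smallest letter m precedes the largest letter M, and it can be moved to the front and
dropped. The induction hypothesis finishes the proof unless the next smallest letter m' lies on
different sides of M in the two words. In that case one explicit chain of jumps,
`forgotten_exchange`, which uses m as an auxiliary letter, joins a word of one kind to a word of the
other; `exists_ascent` supplies such a pair with the required number of inversions.

The generating function is then a count of words. The coefficient of a monomial in the fundamental
function of σ counts the words f of that weight whose stable sorting permutation is σ, so the class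
sum counts the words with inv(f) = inv(U) and with last letter smaller than first letter exactly
when (1,n) is an inversion of U. Foata's bijection turns this into maj(f) = inv(U) together with a
descent at n-1 (`ncard_maj_eq_ncard_inversions`). Finally, a semistandard filling of a ribbon, read
from northwest to southeast, is a word with the descent set of the ribbon, and every subset of 1, …,
n-1 is the descent set of exactly one n-ribbon (`ribbonSum_apply`). -/

theorem exists_first_mem {α : Type*} {l : List α} {p : α → Prop} (h : ∃ d ∈ l, p d) :
    ∃ s d t, l = s ++ d :: t ∧ p d ∧ ∀ c ∈ s, ¬ p c := by
  induction l with
  | nil => simp at h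
  | cons a l ih =>
    by_cases ha : p a
    · exact ⟨[], a, l, rfl, ha, by simp⟩
    · obtain ⟨d, hd, hpd⟩ := h
      have : d ∈ l := by
        rcases List.mem_cons.1 hd with rfl | hd
        · exact absurd hpd ha
        · exact hd
      obtain ⟨s, d, t, rfl, h1, h2⟩ := ih ⟨d, this, hpd⟩
      refine ⟨a :: s, d, t, rfl, h1, ?_⟩
      intro c hc
      rcases List.mem_cons.1 hc with rfl | hc
      · exact ha
      · exact h2 c hc

/-! ### Inversions of lists -/

section Lists

variable {α : Type*} [LinearOrder α]

/-- The number of inversions of a list. -/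
def inversions : List α → ℕ
  | [] => 0
  | a :: l => l.countP (· < a) + inversions l

theorem inversions_append_singleton (l : List α) (a : α) :
    inversions (l ++ [a]) = inversions l + l.countP (a < ·) := by
  induction l with
  | nil => simp [inversions]
  | cons b l ih =>
    simp only [List.cons_append, inversions, ih, List.countP_append, List.countP_cons,
      List.countP_nil]
    omega

theorem inversions_append_left_congr {u v : List α} (h : u.Perm v)
    (huv : inversions u = inversions v) (x : List α) :
    inversions (x ++ u) = inversions (x ++ v) := by
  induction x with
  | nil => exact huv
  | cons a x ih =>
    simp only [List.cons_append, inversions, ih, (h.append_left x).countP_eq]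

theorem inversions_le (l : List α) : inversions l ≤ l.length.choose 2 := by
  induction l with
  | nil => simp [inversions]
  | cons a l ih =>
    have := List.countP_le_length (p := fun x => decide (x < a)) (l := l)
    simp only [inversions, List.length_cons, Nat.choose_succ_succ' _ 1, Nat.choose_one_right,
      one_add_one_eq_two]
    omega

theorem countP_lt_add_countP_gt {l : List α} {a : α} (h : a ∉ l) :
    l.countP (· < a) + l.countP (a < ·) = l.length := by
  induction l with
  | nil => simp
  | cons b l ih =>
    simp only [List.mem_cons, not_or] at h
    have := ih h.2
    rcases lt_or_gt_of_ne h.1 with h1 | h1 <;>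
      simp [h1, h1.not_gt] <;> omega

theorem inversions_add_inversions_reverse {l : List α} (h : l.Nodup) :
    inversions l + inversions l.reverse = l.length.choose 2 := by
  induction l with
  | nil => simp [inversions]
  | cons a l ih =>
    rw [List.nodup_cons] at h
    have h1 := countP_lt_add_countP_gt h.1
    have h2 := ih h.2
    simp only [List.reverse_cons, inversions_append_singleton, inversions, List.countP_reverse,
      List.length_cons, Nat.choose_succ_succ' _ 1, Nat.choose_one_right, one_add_one_eq_two]
    omega

theorem inversions_cons_of_forall_le {l : List α} {a : α} (h : ∀ x ∈ l, a ≤ x) :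
    inversions (a :: l) = inversions l := by
  rw [inversions, List.countP_eq_zero.2 (by simpa using h), zero_add]

theorem inversions_cons_of_forall_lt {l : List α} {a : α} (h : ∀ x ∈ l, x < a) :
    inversions (a :: l) = l.length + inversions l := by
  rw [inversions, List.countP_eq_length.2 (by simpa using h)]

/-! ### The forgotten equivalence -/

/-- In a list, a letter `b` jumps over two adjacent letters one of which is smaller than `b` and
the other one larger. -/
inductive ForgottenStep : List α → List α → Prop
  | right_lt_gt (x y : List α) {a b c : α} (hab : a < b) (hbc : b < c) :
      ForgottenStep (x ++ b :: a :: c :: y) (x ++ a :: c :: b :: y)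
  | left_lt_gt (x y : List α) {a b c : α} (hab : a < b) (hbc : b < c) :
      ForgottenStep (x ++ a :: c :: b :: y) (x ++ b :: a :: c :: y)
  | right_gt_lt (x y : List α) {a b c : α} (hab : a < b) (hbc : b < c) :
      ForgottenStep (x ++ b :: c :: a :: y) (x ++ c :: a :: b :: y)
  | left_gt_lt (x y : List α) {a b c : α} (hab : a < b) (hbc : b < c) :
      ForgottenStep (x ++ c :: a :: b :: y) (x ++ b :: c :: a :: y)

/-- The forgotten equivalence of lists. -/
def Forgotten : List α → List α → Prop := Relation.ReflTransGen ForgottenStep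

theorem ForgottenStep.symm {u v : List α} (h : ForgottenStep u v) : ForgottenStep v u := by
  cases h with
  | right_lt_gt x y hab hbc => exact .left_lt_gt x y hab hbc
  | left_lt_gt x y hab hbc => exact .right_lt_gt x y hab hbc
  | right_gt_lt x y hab hbc => exact .left_gt_lt x y hab hbc
  | left_gt_lt x y hab hbc => exact .right_gt_lt x y hab hbc

theorem ForgottenStep.append_left {u v : List α} (h : ForgottenStep u v) (z : List α) :
    ForgottenStep (z ++ u) (z ++ v) := by
  cases h with
  | right_lt_gt x y hab hbc => simpa using ForgottenStep.right_lt_gt (z ++ x) y hab hbc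
  | left_lt_gt x y hab hbc => simpa using ForgottenStep.left_lt_gt (z ++ x) y hab hbc
  | right_gt_lt x y hab hbc => simpa using ForgottenStep.right_gt_lt (z ++ x) y hab hbc
  | left_gt_lt x y hab hbc => simpa using ForgottenStep.left_gt_lt (z ++ x) y hab hbc

theorem ForgottenStep.reverse {u v : List α} (h : ForgottenStep u v) :
    ForgottenStep u.reverse v.reverse := by
  cases h with
  | right_lt_gt x y hab hbc => simpa using ForgottenStep.left_gt_lt y.reverse x.reverse hab hbc
  | left_lt_gt x y hab hbc => simpa using ForgottenStep.right_gt_lt y.reverse x.reverse hab hbc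
  | right_gt_lt x y hab hbc => simpa using ForgottenStep.left_lt_gt y.reverse x.reverse hab hbc
  | left_gt_lt x y hab hbc => simpa using ForgottenStep.right_lt_gt y.reverse x.reverse hab hbc

theorem perm_jump {α : Type*} (a b c : α) (y : List α) : (b :: a :: c :: y).Perm (a :: c :: b :: y) :=
  (List.Perm.swap a b _).trans ((List.Perm.swap c b y).cons a)

theorem ForgottenStep.perm {u v : List α} (h : ForgottenStep u v) : u.Perm v := by
  cases h with
  | right_lt_gt x y hab hbc => exact (perm_jump _ _ _ _).append_left x
  | left_lt_gt x y hab hbc => exact (perm_jump _ _ _ _).symm.append_left x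
  | right_gt_lt x y hab hbc => exact (perm_jump _ _ _ _).append_left x
  | left_gt_lt x y hab hbc => exact (perm_jump _ _ _ _).symm.append_left x

theorem inversions_jump_lt_gt (y : List α) {a b c : α} (hab : a < b) (hbc : b < c) :
    inversions (b :: a :: c :: y) = inversions (a :: c :: b :: y) := by
  simp [inversions, hab, hbc, hab.not_gt, hbc.not_gt, (hab.trans hbc).not_gt]
  omega

theorem inversions_jump_gt_lt (y : List α) {a b c : α} (hab : a < b) (hbc : b < c) :
    inversions (b :: c :: a :: y) = inversions (c :: a :: b :: y) := by
  simp [inversions, hab, hbc, hab.not_gt, hbc.not_gt, hab.trans hbc]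
  omega

theorem ForgottenStep.inversions_eq {u v : List α} (h : ForgottenStep u v) :
    inversions u = inversions v := by
  cases h with
  | right_lt_gt x y hab hbc =>
    exact inversions_append_left_congr (perm_jump _ _ _ _) (inversions_jump_lt_gt y hab hbc) x
  | left_lt_gt x y hab hbc =>
    exact (inversions_append_left_congr (perm_jump _ _ _ _)
      (inversions_jump_lt_gt y hab hbc) x).symm
  | right_gt_lt x y hab hbc =>
    exact inversions_append_left_congr (perm_jump _ _ _ _) (inversions_jump_gt_lt y hab hbc) x
  | left_gt_lt x y hab hbc =>
    exact (inversions_append_left_congr (perm_jump _ _ _ _)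
      (inversions_jump_gt_lt y hab hbc) x).symm

/-- The jumping letter lies strictly between two others, so it is neither `m` nor `M`. Deleting all
letters except `m` and `M` therefore erases the difference between the two words. -/
theorem ForgottenStep.pair_sublist {u v : List α} (h : ForgottenStep u v) {m M : α}
    (hm : ∀ x ∈ u, m ≤ x) (hM : ∀ x ∈ u, x ≤ M) (hs : [m, M].Sublist u) : [m, M].Sublist v := by
  have key : u.filter (fun x => x = m ∨ x = M) = v.filter (fun x => x = m ∨ x = M) := by
    cases h with
    | right_lt_gt x y hab hbc | left_lt_gt x y hab hbc | right_gt_lt x y hab hbc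
    | left_gt_lt x y hab hbc =>
      rename_i a b c
      have h1 : b ≠ m := ((hm a (by simp)).trans_lt hab).ne'
      have h2 : b ≠ M := (hbc.trans_le (hM c (by simp))).ne
      simp [List.filter_cons, h1, h2]
  have h1 := hs.filter (fun x => decide (x = m ∨ x = M))
  rw [key] at h1
  simp only [List.filter_cons, true_or, or_true, decide_true, if_true, List.filter_nil] at h1
  exact h1.trans List.filter_sublist

theorem Forgotten.refl (u : List α) : Forgotten u u := Relation.ReflTransGen.refl

theorem Forgotten.trans {u v w : List α} (h : Forgotten u v) (h' : Forgotten v w) :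
    Forgotten u w := Relation.ReflTransGen.trans h h'

theorem Forgotten.symm {u v : List α} (h : Forgotten u v) : Forgotten v u := by
  induction h with
  | refl => exact Forgotten.refl _
  | tail _ h ih => exact Relation.ReflTransGen.head h.symm ih

theorem ForgottenStep.forgotten {u v : List α} (h : ForgottenStep u v) : Forgotten u v :=
  Relation.ReflTransGen.single h

theorem Forgotten.append_left {u v : List α} (h : Forgotten u v) (z : List α) :
    Forgotten (z ++ u) (z ++ v) :=
  Relation.ReflTransGen.lift (z ++ ·) (fun _ _ h => ForgottenStep.append_left h z) _ _ h

theorem Forgotten.cons {u v : List α} (h : Forgotten u v) (a : α) :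
    Forgotten (a :: u) (a :: v) := h.append_left [a]

theorem Forgotten.reverse {u v : List α} (h : Forgotten u v) : Forgotten u.reverse v.reverse :=
  Relation.ReflTransGen.lift List.reverse (fun _ _ h => ForgottenStep.reverse h) _ _ h

theorem Forgotten.perm {u v : List α} (h : Forgotten u v) : u.Perm v := by
  induction h with
  | refl => exact List.Perm.refl _
  | tail _ h ih => exact ih.trans h.perm

theorem Forgotten.inversions_eq {u v : List α} (h : Forgotten u v) :
    inversions u = inversions v := by
  induction h with
  | refl => rfl
  | tail _ h ih => exact ih.trans h.inversions_eq

theorem Forgotten.pair_sublist {u v : List α} (h : Forgotten u v) {m M : α}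
    (hm : ∀ x ∈ u, m ≤ x) (hM : ∀ x ∈ u, x ≤ M) (hs : [m, M].Sublist u) : [m, M].Sublist v := by
  induction h with
  | refl => exact hs
  | tail h1 h ih =>
    have hp := Forgotten.perm h1
    exact h.pair_sublist (fun x hx => hm x (hp.mem_iff.2 hx)) (fun x hx => hM x (hp.mem_iff.2 hx))
      ih

theorem Forgotten.pair_sublist_iff {u v : List α} (h : Forgotten u v) {m M : α}
    (hm : ∀ x ∈ u, m ≤ x) (hM : ∀ x ∈ u, x ≤ M) : [m, M].Sublist u ↔ [m, M].Sublist v := by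
  have hp := h.perm
  exact ⟨h.pair_sublist hm hM, h.symm.pair_sublist (fun x hx => hm x (hp.mem_iff.2 hx))
    (fun x hx => hM x (hp.mem_iff.2 hx))⟩

/-! ### Moving the smallest letter to the front -/

theorem forgotten_gt_lt_jump {a c : α} (s z : List α) (h : ∀ b ∈ s, a < b ∧ b < c) :
    Forgotten (c :: a :: (s ++ z)) (s ++ c :: a :: z) := by
  induction s with
  | nil => exact Forgotten.refl _
  | cons b s ih =>
    have hb := h b (by simp)
    have h1 : Forgotten (c :: a :: b :: (s ++ z)) (b :: c :: a :: (s ++ z)) :=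
      (ForgottenStep.left_gt_lt [] _ hb.1 hb.2).forgotten
    exact h1.trans ((ih fun x hx => h x (by simp [hx])).cons b)

theorem forgotten_lt_gt_jump {a c : α} (s z : List α) (h : ∀ b ∈ s, a < b ∧ b < c) :
    Forgotten (a :: c :: (s ++ z)) (s ++ a :: c :: z) := by
  induction s with
  | nil => exact Forgotten.refl _
  | cons b s ih =>
    have hb := h b (by simp)
    have h1 : Forgotten (a :: c :: b :: (s ++ z)) (b :: a :: c :: (s ++ z)) :=
      (ForgottenStep.left_lt_gt [] _ hb.1 hb.2).forgotten
    exact h1.trans ((ih fun x hx => h x (by simp [hx])).cons b)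

/-- Induction on the number of letters before `m`: as long as `M` stands to the right of `m`, a
chain of jumps moves `m` one place to the left and keeps `M` on its right. -/
theorem forgotten_min_cons_aux {m M : α} (N : ℕ) (x y : List α) (hx : x.length = N)
    (hnd : (x ++ m :: y).Nodup) (hm : ∀ z ∈ x ++ m :: y, m ≤ z) (hM : ∀ z ∈ x ++ m :: y, z ≤ M)
    (hy : M ∈ y) : ∃ t, Forgotten (x ++ m :: y) (m :: t) := by
  induction N generalizing x y with
  | zero =>
    rw [List.length_eq_zero_iff] at hx
    subst hx
    exact ⟨y, Forgotten.refl _⟩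
  | succ N ih =>
    obtain ⟨x, b, rfl⟩ : ∃ x' b, x = x' ++ [b] := by
      rcases List.eq_nil_or_concat x with rfl | ⟨x', b, h⟩
      · simp at hx
      · exact ⟨x', b, by simpa using h⟩
    simp only [List.append_assoc, List.cons_append, List.nil_append] at hnd hm hM
    rw [List.nodup_append, List.nodup_cons, List.nodup_cons] at hnd
    obtain ⟨hxn, ⟨hb, hmy, hyn⟩, hdis⟩ := hnd
    have hbM : b < M := lt_of_le_of_ne (hM b (by simp)) (by rintro rfl; simp [hy] at hb)
    -- The letter `d` is the first one after `m` that exceeds `b`; it exists because of `M`. The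
    -- letters `s` before it lie between `m` and `b`, so each of them can jump over the adjacent
    -- pair `b m`.
    obtain ⟨s, d, t, rfl, hd, hs⟩ := exists_first_mem ⟨M, hy, hbM⟩
    have hmb : m < b := lt_of_le_of_ne (hm b (by simp)) (by rintro rfl; simp at hb)
    have hmd : m < d := hmb.trans hd
    have hs' : ∀ c ∈ s, m < c ∧ c < b := by
      intro c hc
      refine ⟨lt_of_le_of_ne (hm c (by simp [hc])) ?_, lt_of_le_of_ne (not_lt.1 (hs c hc)) ?_⟩
      · rintro rfl; simp [hc] at hmy
      · rintro rfl; simp [hc] at hb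
    -- The chain is b m s d → s b m d → s m d b → m d s b.
    have h1 : Forgotten (b :: m :: (s ++ d :: t)) (s ++ b :: m :: d :: t) :=
      forgotten_gt_lt_jump s (d :: t) hs'
    have h2 : Forgotten (s ++ b :: m :: d :: t) (s ++ m :: d :: b :: t) :=
      ((ForgottenStep.right_lt_gt [] t hmb hd).forgotten).append_left s
    have h3 : Forgotten (s ++ m :: d :: b :: t) (m :: d :: (s ++ b :: t)) :=
      (forgotten_lt_gt_jump s (b :: t) fun c hc => ⟨(hs' c hc).1, (hs' c hc).2.trans hd⟩).symm
    have h4 : Forgotten (x ++ [b] ++ m :: (s ++ d :: t)) (x ++ m :: d :: (s ++ b :: t)) := by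
      have := ((h1.trans h2).trans h3).append_left x
      simpa using this
    have hp := h4.perm
    have hnd' : (x ++ [b] ++ m :: (s ++ d :: t)).Nodup := by
      simp only [List.append_assoc, List.cons_append, List.nil_append]
      rw [List.nodup_append, List.nodup_cons, List.nodup_cons]
      exact ⟨hxn, ⟨hb, hmy, hyn⟩, hdis⟩
    obtain ⟨t', ht'⟩ := ih x (d :: (s ++ b :: t)) (by simpa using hx) (hp.nodup_iff.1 hnd')
      (fun z hz => hm z (by simpa using hp.mem_iff.2 hz))
      (fun z hz => hM z (by simpa using hp.mem_iff.2 hz))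
      (by simp at hy ⊢; tauto)
    exact ⟨t', h4.trans ht'⟩

/-- If the smallest letter precedes the largest one, it can be moved to the front. -/
theorem exists_forgotten_min_cons {m M : α} {u : List α} (hnd : u.Nodup) (hm : ∀ z ∈ u, m ≤ z)
    (hM : ∀ z ∈ u, z ≤ M) (hs : [m, M].Sublist u) : ∃ t, Forgotten u (m :: t) := by
  obtain ⟨x, y, rfl, hx, hy⟩ := List.cons_sublist_iff.1 hs
  obtain ⟨x1, x2, rfl⟩ := List.append_of_mem hx
  have hM' : M ∈ x2 ++ y := by
    have := hy.subset (List.mem_singleton.2 rfl)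
    simp [this]
  simpa using forgotten_min_cons_aux _ x1 (x2 ++ y) rfl (by simpa using hnd) (by simpa using hm)
    (by simpa using hM) hM'

/-! ### Arrangements with an initial ascent and a prescribed number of inversions -/

/-- Greedy choice of the last letter: one with t larger letters contributes t inversions at the end
of the word, and the remaining letters are arranged by induction. Only the maximal number of
inversions is excluded, as it would force a descent at the start. -/
theorem exists_ascent_of_pairwise (N : ℕ) (s : List α) (hs : s.Pairwise (· < ·))
    (hN : s.length = N) (h2 : 2 ≤ N) (i : ℕ) (hi : i < N.choose 2) :
    ∃ p q z, p < q ∧ (p :: q :: z).Perm s ∧ inversions (p :: q :: z) = i := by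
  induction N, h2 using Nat.le_induction generalizing s i with
  | base =>
    obtain ⟨p, q, rfl⟩ := List.length_eq_two.1 hN
    have hpq : p < q := by simpa using hs
    refine ⟨p, q, [], hpq, List.Perm.refl _, ?_⟩
    simp [inversions, hpq.not_gt]
    simp at hi
    omega
  | succ N h2 ih =>
    rw [Nat.choose_succ_succ' _ 1, Nat.choose_one_right, one_add_one_eq_two] at hi
    have hpos : 0 < N.choose 2 := Nat.choose_pos h2
    -- The letter at index `N - t` of the increasing list has exactly `t` larger letters. With this
    -- `t`, the rest `i - t` is either 0 or `i - N`, hence below `N.choose 2` in both cases.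
    set t := min i N with ht
    have hlt : N - t < s.length := by omega
    have hdec : s = s.take (N - t) ++ s[N - t] :: s.drop (N - t + 1) := by simp
    set l₁ := s.take (N - t)
    set l₂ := s.drop (N - t + 1) with hl₂
    set x := s[N - t]
    rw [hdec, List.pairwise_append, List.pairwise_cons] at hs
    obtain ⟨hs1, ⟨hs2, hs3⟩, hs4⟩ := hs
    have hsub : (l₁ ++ l₂).Pairwise (· < ·) :=
      List.pairwise_append.2 ⟨hs1, hs3, fun a ha b hb => hs4 a ha b (by simp [hb])⟩
    have hlen : (l₁ ++ l₂).length = N := by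
      have := congrArg List.length hdec
      simp only [List.length_append, List.length_cons] at this ⊢
      omega
    obtain ⟨p, q, z, hpq, hperm, hinv⟩ := ih (l₁ ++ l₂) hsub hlen (i - t) (by omega)
    refine ⟨p, q, z ++ [x], hpq, ?_, ?_⟩
    · rw [hdec]
      refine List.Perm.trans ?_ List.perm_middle.symm
      exact (List.perm_append_singleton x (p :: q :: z)).trans (hperm.cons x)
    · have h1 : l₁.countP (x < ·) = 0 := by
        rw [List.countP_eq_zero]
        intro a ha
        simpa using (hs4 a ha x (by simp)).le
      have h2 : l₂.countP (x < ·) = l₂.length := by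
        rw [List.countP_eq_length]
        simpa using hs2
      have h3 : l₂.length = t := by
        rw [hl₂, List.length_drop]
        omega
      have := inversions_append_singleton (p :: q :: z) x
      rw [List.cons_append, List.cons_append] at this
      rw [this, hinv, hperm.countP_eq, List.countP_append, h1, h2, h3]
      omega

/-- The numbers of inversions of arrangements that begin with an ascent. -/
theorem exists_ascent (s : List α) (hs : s.Nodup) (i : ℕ) (hi : i < s.length.choose 2) :
    ∃ p q z, p < q ∧ (p :: q :: z).Perm s ∧ inversions (p :: q :: z) = i := by
  have hp : (s.insertionSort (· ≤ ·)).Perm s := List.perm_insertionSort _ s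
  have h2 : 2 ≤ s.length := by
    by_contra h
    rw [Nat.choose_eq_zero_of_lt (by omega)] at hi
    omega
  have hsorted : (s.insertionSort (· ≤ ·)).Pairwise (· < ·) := by
    have h1 := List.pairwise_insertionSort (· ≤ ·) s
    have h3 : (s.insertionSort (· ≤ ·)).Pairwise (· ≠ ·) := hp.nodup_iff.2 hs
    exact h1.imp₂ (fun _ _ h h' => lt_of_le_of_ne h h') h3
  obtain ⟨p, q, z, h1, h2, h3⟩ :=
    exists_ascent_of_pairwise _ _ hsorted hp.length_eq h2 i hi
  exact ⟨p, q, z, h1, h2.trans hp, h3⟩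

/-! ### Order of the extreme letters and bounds on the number of inversions -/

theorem pair_sublist_or {α : Type*} {u : List α} {m M : α} (hm : m ∈ u) (hM : M ∈ u) (hne : m ≠ M) :
    [m, M].Sublist u ∨ [M, m].Sublist u := by
  obtain ⟨x, y, rfl⟩ := List.append_of_mem hm
  simp only [List.mem_append, List.mem_cons, hne.symm, false_or] at hM
  rcases hM with h | h
  · right
    exact (List.singleton_sublist.2 h).append (List.singleton_sublist.2 (by simp))
  · left
    exact ((List.singleton_sublist.2 h).cons_cons m).trans (List.sublist_append_right _ _)

theorem eq_of_perm_of_forall_eq {α : Type*} {u v : List α} {a : α} (h : u.Perm v)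
    (hu : ∀ z ∈ u, z = a) : u = v := by
  rw [List.eq_replicate_of_mem hu, List.eq_replicate_of_mem fun z hz => hu z (h.mem_iff.2 hz),
    h.length_eq]

theorem not_pair_sublist {u : List α} (hu : u.Nodup) {m M : α} (h : [m, M].Sublist u) :
    ¬ [M, m].Sublist u := by
  intro h'
  have hne : m ≠ M := by
    have := h.nodup hu
    simpa using this
  induction u with
  | nil => simp at h
  | cons a u ih =>
    rw [List.nodup_cons] at hu
    by_cases ham : a = m
    · subst ham
      rcases List.sublist_cons_iff.1 h' with h2 | ⟨r, h2, -⟩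
      · exact hu.1 (h2.subset (by simp))
      · simp at h2; exact hne h2.1.symm
    · by_cases haM : a = M
      · subst haM
        rcases List.sublist_cons_iff.1 h with h2 | ⟨r, h2, -⟩
        · exact hu.1 (h2.subset (by simp))
        · simp at h2; exact hne h2.1
      · refine ih hu.2 ?_ ?_
        · rcases List.sublist_cons_iff.1 h with h2 | ⟨r, h2, -⟩
          · exact h2
          · simp at h2; exact absurd h2.1.symm ham
        · rcases List.sublist_cons_iff.1 h' with h2 | ⟨r, h2, -⟩
          · exact h2
          · simp at h2; exact absurd h2.1.symm haM

/-- After reversal the smallest letter can be moved to the front, so here it can be moved to the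
end, where it forms an inversion with every other letter. -/
theorem length_le_inversions {m M : α} {u : List α} (hnd : u.Nodup) (hm : ∀ z ∈ u, m ≤ z)
    (hM : ∀ z ∈ u, z ≤ M) (hs : [M, m].Sublist u) : u.length ≤ inversions u + 1 := by
  obtain ⟨t, ht⟩ := exists_forgotten_min_cons (u := u.reverse) (m := m) (M := M) (by simpa using hnd)
    (by simpa using hm) (by simpa using hM) (by simpa using hs.reverse)
  have h1 := ht.reverse
  rw [List.reverse_reverse, List.reverse_cons] at h1
  have hnd' := h1.perm.nodup_iff.1 hnd
  rw [List.nodup_append] at hnd'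
  rw [h1.inversions_eq, inversions_append_singleton, h1.perm.length_eq, List.length_append,
    List.countP_eq_length.2]
  · simp
  · intro a ha
    have h2 : m ≤ a := hm a (h1.perm.mem_iff.2 (by simp at ha ⊢; simp [ha]))
    have h3 : a ≠ m := hnd'.2.2 a ha m (by simp)
    simpa using lt_of_le_of_ne h2 h3.symm

/-- Once moved to the front, the smallest letter takes part in no inversion. -/
theorem inversions_le_of_min_before_max {m M : α} {u : List α} (hnd : u.Nodup)
    (hm : ∀ z ∈ u, m ≤ z) (hM : ∀ z ∈ u, z ≤ M) (hs : [m, M].Sublist u) :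
    inversions u ≤ (u.length - 1).choose 2 := by
  obtain ⟨t, ht⟩ := exists_forgotten_min_cons hnd hm hM hs
  rw [ht.inversions_eq, ht.perm.length_eq, inversions_cons_of_forall_le]
  · exact inversions_le t
  · intro x hx
    exact hm x (ht.perm.mem_iff.2 (by simp [hx]))

/-- The key instance of the forgotten equivalence that changes the relative order of the second
smallest letter and the largest one. -/
theorem forgotten_exchange {m m' M p q : α} (z : List α) (h1 : m < m') (h2 : m' < p) (h3 : p < q)
    (h4 : q < M) :
    Forgotten (m :: M :: m' :: p :: q :: z) (m :: q :: m' :: M :: p :: z) := by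
  have e1 : Forgotten (m :: M :: m' :: p :: q :: z) (m' :: m :: M :: p :: q :: z) :=
    (ForgottenStep.left_lt_gt [] _ h1 (h2.trans (h3.trans h4))).forgotten
  have e2 : Forgotten (m' :: m :: M :: p :: q :: z) (m' :: m :: q :: M :: p :: z) :=
    (ForgottenStep.left_gt_lt [m', m] z h3 h4).forgotten
  have e3 : Forgotten (m' :: m :: q :: M :: p :: z) (m :: q :: m' :: M :: p :: z) :=
    (ForgottenStep.right_lt_gt [] _ h1 (h2.trans h3)).forgotten
  exact (e1.trans e2).trans e3

/-! ### Completeness of the two invariants -/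

theorem exists_min_max {u : List α} (h : u ≠ []) :
    ∃ m M, m ∈ u ∧ M ∈ u ∧ (∀ z ∈ u, m ≤ z) ∧ ∀ z ∈ u, z ≤ M := by
  obtain ⟨a, ha⟩ := List.exists_mem_of_ne_nil u h
  obtain ⟨m, hm, hm'⟩ := u.toFinset.exists_min_image id ⟨a, by simpa using ha⟩
  obtain ⟨M, hM, hM'⟩ := u.toFinset.exists_max_image id ⟨a, by simpa using ha⟩
  exact ⟨m, M, by simpa using hm, by simpa using hM, by simpa using hm', by simpa using hM'⟩

/-- Lists without repetitions that have the same letters and the same number of inversions, and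
agree in the relative order of the smallest and the largest letter. -/
structure SameClass (m M : α) (u v : List α) : Prop where
  nodup : u.Nodup
  perm : u.Perm v
  min_le : ∀ z ∈ u, m ≤ z
  le_max : ∀ z ∈ u, z ≤ M
  min_mem : m ∈ u
  max_mem : M ∈ u
  inversions_eq : inversions u = inversions v
  order : [m, M].Sublist u ↔ [m, M].Sublist v

/-- The case in which the induction hypothesis does not connect `u` with `v`, since m' and M occur
in different orders. It does connect `v` with M m' p q z and `u` with q m' M p z, and these two
words become equivalent once the smaller letter `m` is put in front (`forgotten_exchange`). -/
theorem forgotten_cons_of_mixed {m m' M : α} {u v : List α}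
    (ih : ∀ u' v' : List α, u'.length = u.length → SameClass m' M u' v' → Forgotten u' v')
    (hnd : u.Nodup) (hp : u.Perm v) (hm' : ∀ z ∈ u, m' ≤ z) (hM : ∀ z ∈ u, z ≤ M)
    (hm'u : m' ∈ u) (hMu : M ∈ u) (hne : m' ≠ M) (hinv : inversions u = inversions v)
    (hu : [m', M].Sublist u) (hv : [M, m'].Sublist v) (hm : m < m') :
    Forgotten (m :: u) (m :: v) := by
  have hvM : ∀ z ∈ v, z ≤ M := fun z hz => hM z (hp.mem_iff.2 hz)
  have hvm : ∀ z ∈ v, m' ≤ z := fun z hz => hm' z (hp.mem_iff.2 hz)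
  have hvnd : v.Nodup := hp.nodup_iff.1 hnd
  have b1 := inversions_le_of_min_before_max hnd hm' hM hu
  have b2 := length_le_inversions hvnd hvm hvM hv
  rw [← hp.length_eq, ← hinv] at b2
  set s := (u.erase m').erase M with hs
  have hMe : M ∈ u.erase m' := (List.mem_erase_of_ne hne.symm).2 hMu
  have hus : u.Perm (m' :: M :: s) :=
    (List.perm_cons_erase hm'u).trans ((List.perm_cons_erase hMe).cons m')
  have hlen : u.length = s.length + 2 := by simpa using hus.length_eq
  have hnd2 := hus.nodup_iff.1 hnd
  simp only [List.nodup_cons, List.mem_cons, not_or] at hnd2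
  have hlow : ∀ z ∈ s, m' < z := fun z hz => lt_of_le_of_ne
    (hm' z (hus.mem_iff.2 (by simp [hz]))) (by rintro rfl; exact hnd2.1.2 hz)
  have hhigh : ∀ z ∈ s, z < M := fun z hz => lt_of_le_of_ne
    (hM z (hus.mem_iff.2 (by simp [hz]))) (by rintro rfl; exact hnd2.2.1 hz)
  have hchoose : (u.length - 1).choose 2 = s.length + s.length.choose 2 := by
    rw [hlen, show s.length + 2 - 1 = s.length + 1 from rfl, Nat.choose_succ_succ' _ 1,
      Nat.choose_one_right, one_add_one_eq_two]
  -- In M m' p q z the letter M accounts for `s.length + 1` inversions and m' for none, so p q z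
  -- must supply the rest. The bounds `b1` and `b2` place this rest in the range allowed by
  -- `exists_ascent`.
  obtain ⟨p, q, z, hpq, hpz, hiz⟩ := exists_ascent s hnd2.2.2 (inversions u - (s.length + 1))
    (by omega)
  have hps : ∀ x ∈ p :: q :: z, x ∈ s := fun x hx => hpz.mem_iff.1 hx
  have ex := forgotten_exchange z hm (hlow p (hps p (by simp))) hpq (hhigh q (hps q (by simp)))
  have pv : v.Perm (M :: m' :: p :: q :: z) := by
    refine hp.symm.trans (hus.trans ((List.Perm.swap M m' s).trans ?_))
    exact (hpz.symm.cons m').cons M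
  have pu : u.Perm (q :: m' :: M :: p :: z) := hp.trans (pv.trans (ex.perm.cons_inv))
  have iv : inversions (M :: m' :: p :: q :: z) = inversions u := by
    rw [inversions_cons_of_forall_lt, inversions_cons_of_forall_le, hiz]
    · have := hpz.length_eq
      simp only [List.length_cons] at this ⊢
      omega
    · exact fun x hx => (hlow x (hps x hx)).le
    · intro x hx
      rcases List.mem_cons.1 hx with rfl | hx
      · exact lt_of_le_of_ne (hM _ hm'u) hne
      · exact hhigh x (hps x hx)
  have iu : inversions (q :: m' :: M :: p :: z) = inversions u := by
    have := ex.inversions_eq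
    rw [inversions_cons_of_forall_le fun x hx => hm.le.trans (hvm x (pv.mem_iff.2 hx)),
      inversions_cons_of_forall_le fun x hx => hm.le.trans (hm' x (pu.mem_iff.2 hx)), iv] at this
    exact this.symm
  have su : Forgotten u (q :: m' :: M :: p :: z) :=
    ih _ _ rfl ⟨hnd, pu, hm', hM, hm'u, hMu, iu.symm, by
      simp only [hu, true_iff]
      exact ((List.nil_sublist _).cons_cons M |>.cons_cons m').cons q⟩
  have sv : Forgotten v (M :: m' :: p :: q :: z) :=
    ih _ _ hp.length_eq.symm ⟨hvnd, pv, hvm, hvM, hp.mem_iff.1 hm'u, hp.mem_iff.1 hMu,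
      by rw [iv, hinv], by
      simp only [not_pair_sublist hvnd hv, false_iff]
      exact not_pair_sublist (pv.nodup_iff.1 hvnd) ((List.nil_sublist _).cons_cons m' |>.cons_cons M)⟩
  exact (su.cons m).trans (ex.symm.trans (sv.cons m).symm)

/-- The inductive step when the smallest letter precedes the largest: bring it to the front of both
words and compare the remainders, which still have equal inversion numbers and the same largest
letter. -/
theorem forgotten_of_sameClass_of_sublist {N : ℕ} {m M : α} {u v : List α}
    (ih : ∀ (m M : α) (u v : List α), u.length = N → SameClass m M u v → Forgotten u v)
    (hN : u.length = N + 1) (h : SameClass m M u v) (hs : [m, M].Sublist u) :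
    Forgotten u v := by
  have hsv := h.order.1 hs
  have hvnd := h.perm.nodup_iff.1 h.nodup
  obtain ⟨u', hu'⟩ := exists_forgotten_min_cons h.nodup h.min_le h.le_max hs
  obtain ⟨v', hv'⟩ := exists_forgotten_min_cons hvnd
    (fun z hz => h.min_le z (h.perm.mem_iff.2 hz))
    (fun z hz => h.le_max z (h.perm.mem_iff.2 hz)) hsv
  refine hu'.trans (Forgotten.trans ?_ hv'.symm)
  have hp : u'.Perm v' := (hu'.perm.symm.trans (h.perm.trans hv'.perm)).cons_inv
  have hnd := hu'.perm.nodup_iff.1 h.nodup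
  rw [List.nodup_cons] at hnd
  have hmu : ∀ z ∈ u', m < z := fun z hz => lt_of_le_of_ne
    (h.min_le z (hu'.perm.mem_iff.2 (by simp [hz]))) (by rintro rfl; exact hnd.1 hz)
  have hMu : ∀ z ∈ u', z ≤ M := fun z hz => h.le_max z (hu'.perm.mem_iff.2 (by simp [hz]))
  have hinv : inversions u' = inversions v' := by
    have := hu'.inversions_eq.symm.trans (h.inversions_eq.trans hv'.inversions_eq)
    rwa [inversions_cons_of_forall_le fun z hz => (hmu z hz).le,
      inversions_cons_of_forall_le fun z hz => (hmu z (hp.mem_iff.2 hz)).le] at this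
  have hlen : u'.length = N := by
    have := hu'.perm.length_eq
    simp at this
    omega
  have hne : m ≠ M := by
    have := hs.nodup h.nodup
    simpa using this
  have hM : M ∈ u' := by
    have := hu'.perm.mem_iff.1 h.max_mem
    simpa [hne.symm] using this
  obtain ⟨m', -, hm', -, hm'le, -⟩ := exists_min_max (List.ne_nil_of_mem hM)
  by_cases hmM : m' = M
  · rw [eq_of_perm_of_forall_eq hp fun z hz => le_antisymm (hMu z hz) (hmM ▸ hm'le z hz)]
    exact Forgotten.refl _
  · have hvm : m' ∈ v' := hp.mem_iff.1 hm'
    have hvM : M ∈ v' := hp.mem_iff.1 hM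
    have hv'nd := hp.nodup_iff.1 hnd.2
    -- If the new smallest letter and M have the same order in both remainders, the induction
    -- hypothesis applies directly; otherwise the exchange argument is needed, in one direction or
    -- the other.
    rcases pair_sublist_or hm' hM hmM with a | a <;>
      rcases pair_sublist_or hvm hvM hmM with b | b
    · exact (ih m' M u' v' hlen ⟨hnd.2, hp, hm'le, hMu, hm', hM, hinv, by simp [a, b]⟩).cons m
    · exact forgotten_cons_of_mixed (fun x y hx => ih m' M x y (hx.trans hlen)) hnd.2 hp hm'le hMu
        hm' hM hmM hinv a b (hmu m' hm')
    · exact (forgotten_cons_of_mixed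
        (fun x y hx => ih m' M x y (hx.trans (hp.length_eq.symm.trans hlen))) hv'nd hp.symm
        (fun z hz => hm'le z (hp.mem_iff.2 hz)) (fun z hz => hMu z (hp.mem_iff.2 hz))
        hvm hvM hmM hinv.symm b a (hmu m' hm')).symm
    · exact (ih m' M u' v' hlen ⟨hnd.2, hp, hm'le, hMu, hm', hM, hinv, by
        simp [not_pair_sublist hnd.2 a, not_pair_sublist hv'nd b]⟩).cons m

/-- Reversal complements the number of inversions to `length.choose 2` and flips the order of the
two extreme letters, in both words alike. -/
theorem SameClass.reverse {m M : α} {u v : List α} (h : SameClass m M u v) (hne : m ≠ M) :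
    SameClass m M u.reverse v.reverse where
  nodup := by simpa using h.nodup
  perm := by simpa using h.perm
  min_le := by simpa using h.min_le
  le_max := by simpa using h.le_max
  min_mem := by simpa using h.min_mem
  max_mem := by simpa using h.max_mem
  inversions_eq := by
    have h1 := inversions_add_inversions_reverse h.nodup
    have h2 := inversions_add_inversions_reverse (h.perm.nodup_iff.1 h.nodup)
    rw [h.perm.length_eq] at h1
    have := h.inversions_eq
    omega
  order := by
    have hvnd := h.perm.nodup_iff.1 h.nodup
    have e : ∀ w : List α, w.Nodup → m ∈ w → M ∈ w →
        ([m, M].Sublist w.reverse ↔ ¬ [m, M].Sublist w) := by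
      intro w hw h1 h2
      have e1 : [m, M].Sublist w.reverse ↔ [M, m].Sublist w := by
        rw [← List.reverse_sublist]
        simp
      rw [e1]
      exact ⟨not_pair_sublist hw, fun h3 => (pair_sublist_or h1 h2 hne).resolve_left h3⟩
    rw [e u h.nodup h.min_mem h.max_mem,
      e v hvnd (h.perm.mem_iff.1 h.min_mem) (h.perm.mem_iff.1 h.max_mem), h.order]

/-- The number of inversions and the relative order of the smallest and the largest letter
determine the forgotten class of a list without repetitions. -/
theorem SameClass.forgotten {m M : α} {u v : List α} (h : SameClass m M u v) :
    Forgotten u v := by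
  obtain ⟨N, hN⟩ : ∃ N, u.length = N := ⟨_, rfl⟩
  induction N generalizing m M u v with
  | zero =>
    rw [List.length_eq_zero_iff] at hN
    have := h.min_mem
    simp [hN] at this
  | succ N ih =>
    by_cases hne : m = M
    · rw [eq_of_perm_of_forall_eq h.perm fun z hz => le_antisymm (h.le_max z hz)
        (hne ▸ h.min_le z hz)]
      exact Forgotten.refl _
    · rcases pair_sublist_or h.min_mem h.max_mem hne with hs | hs
      · exact forgotten_of_sameClass_of_sublist (fun _ _ _ _ hl h => ih h hl) hN h hs
      · have := (forgotten_of_sameClass_of_sublist (fun _ _ _ _ hl h => ih h hl) (by simpa using hN)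
          (h.reverse hne) (by simpa using hs.reverse)).reverse
        simpa using this

end Lists

section Foata

variable {α : Type*} [LinearOrder α]

/-! ### Foata's bijection -/

/-- Cut a list after each letter that satisfies `p`, and move the last letter of each block to the
front of the block. -/
def rotateBlocks (p : α → Bool) : List α → List α
  | [] => []
  | x :: t =>
    if p x then x :: rotateBlocks p t
    else match rotateBlocks p t with
      | [] => [x]
      -- If the list ends in a letter satisfying `p`, then `y` is the letter that closes the block
      -- of `x`, on its way to the front of that block.
      | y :: s => y :: x :: s

omit [LinearOrder α] in
theorem rotateBlocks_perm (p : α → Bool) (t : List α) : (rotateBlocks p t).Perm t := by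
  induction t with
  | nil => exact List.Perm.refl _
  | cons x t ih =>
    rw [rotateBlocks]
    split_ifs
    · exact ih.cons x
    · cases h : rotateBlocks p t with
      | nil =>
        rw [h] at ih
        rw [← ih.nil_eq]
      | cons y s =>
        rw [h] at ih
        exact (List.Perm.swap x y s).trans (ih.cons x)

omit [LinearOrder α] in
theorem exists_rotateBlocks_eq_cons (p : α → Bool) {t : List α} (ht : t ≠ [])
    (hp : ∀ y ∈ t.getLast?, p y) : ∃ y s, rotateBlocks p t = y :: s ∧ p y := by
  induction t with
  | nil => exact absurd rfl ht
  | cons x t ih =>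
    rw [rotateBlocks]
    split_ifs with h
    · exact ⟨_, _, rfl, h⟩
    · have ht : t ≠ [] := by
        rintro rfl
        exact h (hp x (by simp))
      obtain ⟨y, s, h1, h2⟩ := ih ht (by rwa [List.getLast?_cons_of_ne_nil ht] at hp)
      exact ⟨y, x :: s, by rw [h1], h2⟩

omit [LinearOrder α] in
-- When the last letter satisfies `p`, every block closes with its only letter satisfying `p`. After
-- the rotation such letters open the blocks, so the cuts can be recovered.
theorem rotateBlocks_inj (p : α → Bool) {t t' : List α} (hp : ∀ y ∈ t.getLast?, p y)
    (hp' : ∀ y ∈ t'.getLast?, p y) (h : rotateBlocks p t = rotateBlocks p t') : t = t' := by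
  have key : ∀ (x : α) (t : List α), (∀ y ∈ (x :: t).getLast?, p y) →
      (p x ∧ (∀ y ∈ t.getLast?, p y) ∧ rotateBlocks p (x :: t) = x :: rotateBlocks p t ∧
        ∀ z ∈ (rotateBlocks p t).head?, p z) ∨
      (¬ p x ∧ (∀ y ∈ t.getLast?, p y) ∧ ∃ y s, rotateBlocks p t = y :: s ∧
        rotateBlocks p (x :: t) = y :: x :: s) := by
    intro x t hp
    have ht : ∀ y ∈ t.getLast?, p y := by
      rcases eq_or_ne t [] with rfl | ht
      · simp
      · rwa [List.getLast?_cons_of_ne_nil ht] at hp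
    by_cases hx : p x
    · refine .inl ⟨hx, ht, by rw [rotateBlocks, if_pos hx], ?_⟩
      rcases eq_or_ne t [] with rfl | hne
      · simp [rotateBlocks]
      · obtain ⟨y, s, h1, h2⟩ := exists_rotateBlocks_eq_cons p hne ht
        simpa [h1] using h2
    · have hne : t ≠ [] := by
        rintro rfl
        exact hx (hp x (by simp))
      obtain ⟨y, s, h1, h2⟩ := exists_rotateBlocks_eq_cons p hne ht
      exact .inr ⟨hx, ht, y, s, h1, by rw [rotateBlocks, if_neg hx, h1]⟩
  induction t generalizing t' with
  | nil =>
    have := (rotateBlocks_perm p t').length_eq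
    rw [← h] at this
    exact (List.length_eq_zero_iff.1 this.symm).symm
  | cons x t ih =>
    cases t' with
    | nil =>
      have := (rotateBlocks_perm p (x :: t)).length_eq
      rw [h] at this
      simp [rotateBlocks] at this
    | cons x' t' =>
      rcases key x t hp with ⟨h1, h2, h3, h4⟩ | ⟨h1, h2, y, s, h3, h4⟩ <;>
        rcases key x' t' hp' with ⟨k1, k2, k3, k4⟩ | ⟨k1, k2, y', s', k3, k4⟩
      · rw [h3, k3, List.cons.injEq] at h
        rw [h.1, ih h2 k2 h.2]
      · rw [h3, k4, List.cons.injEq] at h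
        rw [h.2] at h4
        exact absurd (h4 x' (by simp)) k1
      · rw [h4, k3, List.cons.injEq] at h
        rw [← h.2] at k4
        exact absurd (k4 x (by simp)) h1
      · rw [h4, k4, List.cons.injEq, List.cons.injEq] at h
        rw [h.2.1, ih h2 k2 (by rw [h3, k3, h.1, h.2.2])]

/-- Every letter outside `p` is passed by exactly one letter in `p`, the one that closes its block,
and each such passage creates an inversion. -/
theorem inversions_rotateBlocks_of_lt (p : α → Bool) (h : ∀ x y, ¬ p x → p y → x < y) {t : List α}
    (hp : ∀ y ∈ t.getLast?, p y) :
    inversions (rotateBlocks p t) = inversions t + t.countP (fun x => !p x) := by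
  induction t with
  | nil => simp [rotateBlocks, inversions]
  | cons x t ih =>
    rcases eq_or_ne t [] with rfl | hne
    · have : p x := hp x (by simp)
      simp [rotateBlocks, this]
    rw [List.getLast?_cons_of_ne_nil hne] at hp
    have ih := ih hp
    have hperm := rotateBlocks_perm p t
    rw [rotateBlocks]
    split_ifs with hx
    · simp [inversions, hperm.countP_eq, ih, hx]
      omega
    · obtain ⟨y, s, h1, h2⟩ := exists_rotateBlocks_eq_cons p hne hp
      have hxy := h x y hx h2
      have e := hperm.countP_eq (fun z => decide (z < x))
      rw [h1] at ih e
      rw [h1]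
      simp [inversions, hxy, hxy.not_gt, hx] at ih e ⊢
      omega

/-- As in `inversions_rotateBlocks_of_lt`, but each passage now destroys an inversion. -/
theorem inversions_rotateBlocks_of_gt (p : α → Bool) (h : ∀ x y, ¬ p x → p y → y < x) {t : List α}
    (hp : ∀ y ∈ t.getLast?, p y) :
    inversions (rotateBlocks p t) + t.countP (fun x => !p x) = inversions t := by
  induction t with
  | nil => simp [rotateBlocks, inversions]
  | cons x t ih =>
    rcases eq_or_ne t [] with rfl | hne
    · have : p x := hp x (by simp)
      simp [rotateBlocks, this]
    rw [List.getLast?_cons_of_ne_nil hne] at hp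
    have ih := ih hp
    have hperm := rotateBlocks_perm p t
    rw [rotateBlocks]
    split_ifs with hx
    · simp [inversions, hperm.countP_eq, ← ih, hx]
      omega
    · obtain ⟨y, s, h1, h2⟩ := exists_rotateBlocks_eq_cons p hne hp
      have hxy := h x y hx h2
      have e := hperm.countP_eq (fun z => decide (z < x))
      rw [h1] at ih e
      rw [h1]
      simp [inversions, hxy, hxy.not_gt, hx] at ih e ⊢
      omega

/-- The major index of a word, given as the reversed list of its letters. -/
def majRev : List α → ℕ
  | [] => 0
  | a :: u => majRev u + if u.head?.any (a < ·) then u.length else 0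

/-- The image under Foata's bijection of a word that is given as the reversed list of its
letters. -/
def foata : List α → List α
  | [] => []
  -- The blocks end at the letters that lie on the same side of `a` as the preceding letter of the
  -- word. That letter is also the last letter of `foata u`, so the final block is complete.
  | a :: u => rotateBlocks (fun x => decide (a < x) == u.head?.any (a < ·)) (foata u) ++ [a]

theorem foata_perm (u : List α) : (foata u).Perm u := by
  induction u with
  | nil => exact List.Perm.refl _
  | cons a u ih =>
    rw [foata]
    exact (List.perm_append_singleton a _).trans (((rotateBlocks_perm _ _).trans ih).cons a)

theorem getLast?_foata (u : List α) : (foata u).getLast? = u.head? := by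
  cases u <;> simp [foata]

theorem forall_mem_getLast?_foata (a : α) (u : List α) :
    ∀ y ∈ (foata u).getLast?, decide (a < y) == u.head?.any (a < ·) := by
  rw [getLast?_foata]
  intro y hy
  rw [Option.mem_def.1 hy]
  simp

theorem foata_injective : Function.Injective (foata (α := α)) := by
  intro u v h
  induction u generalizing v with
  | nil =>
    have := (foata_perm v).length_eq
    rw [← h] at this
    exact (List.length_eq_zero_iff.1 this.symm).symm
  | cons a u ih =>
    cases v with
    | nil =>
      have := (foata_perm (a :: u)).length_eq
      rw [h] at this
      simp [foata] at this
    | cons b v =>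
      rw [foata, foata, List.append_singleton_inj] at h
      obtain ⟨h, rfl⟩ := h
      have hl : (foata u).length = (foata v).length := by
        rw [← (rotateBlocks_perm _ (foata u)).length_eq, h, (rotateBlocks_perm _ _).length_eq]
      rcases eq_or_ne (foata u) [] with hu | hu
      · rw [hu] at hl
        rw [ih (hu.trans (List.length_eq_zero_iff.1 hl.symm).symm)]
      have hv : foata v ≠ [] := by
        intro hv
        rw [hv] at hl
        exact hu (List.length_eq_zero_iff.1 hl)
      obtain ⟨y, s, h1, h2⟩ := exists_rotateBlocks_eq_cons _ hu (forall_mem_getLast?_foata a u)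
      obtain ⟨y', s', k1, k2⟩ := exists_rotateBlocks_eq_cons _ hv (forall_mem_getLast?_foata a v)
      -- The first letter of the rotated list satisfies the cutting predicate, so its comparison
      -- with `a` reveals which predicate was used.
      have hb : u.head?.any (a < ·) = v.head?.any (a < ·) := by
        rw [h1, k1, List.cons.injEq] at h
        rw [← h.1] at k2
        rw [← beq_iff_eq.1 h2, ← beq_iff_eq.1 k2]
      have hv' := forall_mem_getLast?_foata a v
      rw [← hb] at h hv'
      rw [ih (rotateBlocks_inj _ (forall_mem_getLast?_foata a u) hv' h)]

/-- At a descent, the rotation creates one inversion for each letter at most `a`, and appending `a`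
creates one for each letter above it: `u.length` in total. Otherwise the rotation destroys one
inversion for each letter above `a`, and appending `a` restores them, so the total does not change.
-/
theorem inversions_foata (u : List α) : inversions (foata u) = majRev u := by
  induction u with
  | nil => rfl
  | cons a u ih =>
    have hl := (foata_perm u).length_eq
    have hlast := forall_mem_getLast?_foata a u
    rw [foata, inversions_append_singleton, (rotateBlocks_perm _ _).countP_eq, majRev]
    cases hb : u.head?.any (a < ·) with
    | true =>
      rw [hb] at hlast
      have h := inversions_rotateBlocks_of_lt (fun x => decide (a < x) == true)
        (by intro x y hx hy; simp at hx hy; exact hx.trans_lt hy) hlast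
      have h' := List.length_eq_countP_add_countP (fun x => decide (a < x)) (l := foata u)
      simp only [beq_true] at h ⊢
      rw [h]
      simp only [decide_not, decide_eq_true_eq] at h' ⊢
      simp at h' ⊢
      omega
    | false =>
      rw [hb] at hlast
      have h := inversions_rotateBlocks_of_gt (fun x => decide (a < x) == false)
        (by intro x y hx hy; simp at hx hy; exact hy.trans_lt hx) hlast
      simp only [beq_false, Bool.not_not] at h ⊢
      simp
      omega

/-- The last step of a word is a descent if and only if the first letter of its Foata image is
larger than the last one. -/
theorem head?_foata_any_lt (a : α) (u : List α) :
    (foata (a :: u)).head?.any (a < ·) = u.head?.any (a < ·) := by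
  rw [foata]
  rcases eq_or_ne (foata u) [] with hu | hu
  · have : u = [] := foata_injective hu
    subst this
    simp [foata, rotateBlocks]
  · obtain ⟨y, s, h1, h2⟩ := exists_rotateBlocks_eq_cons _ hu (forall_mem_getLast?_foata a u)
    rw [h1, ← beq_iff_eq.1 h2]
    simp

/-! ### Words as functions -/

/-- The descent set of a word. -/
def descents {n : ℕ} (f : Fin n → α) : Finset ℕ :=
  (Finset.Icc 1 (n - 1)).filter fun i => ∃ h : i < n, f ⟨i, h⟩ < f ⟨i - 1, by omega⟩

theorem mem_descents {n : ℕ} {f : Fin n → α} {i : ℕ} :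
    i ∈ descents f ↔ 1 ≤ i ∧ ∃ h : i < n, f ⟨i, h⟩ < f ⟨i - 1, by omega⟩ := by
  simp only [descents, Finset.mem_filter, Finset.mem_Icc]
  constructor
  · rintro ⟨⟨h1, h2⟩, h⟩
    exact ⟨h1, h⟩
  · rintro ⟨h1, h, h2⟩
    exact ⟨⟨h1, by omega⟩, h, h2⟩

omit [LinearOrder α] in
theorem reverse_ofFn_succ {n : ℕ} (f : Fin (n + 1) → α) :
    (List.ofFn f).reverse = f (Fin.last n) :: (List.ofFn fun i : Fin n => f i.castSucc).reverse := by
  rw [List.ofFn_succ', List.concat_eq_append, List.reverse_append]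
  rfl

theorem head?_reverse_ofFn_any {n : ℕ} (f : Fin (n + 1) → α) :
    (List.ofFn fun i : Fin n => f i.castSucc).reverse.head?.any (f (Fin.last n) < ·) = true ↔
      n ∈ descents f := by
  rw [mem_descents]
  cases n with
  | zero => simp
  | succ n =>
    rw [reverse_ofFn_succ]
    simp
    rfl

theorem majRev_reverse_ofFn {n : ℕ} (f : Fin n → α) :
    majRev (List.ofFn f).reverse = ∑ i ∈ descents f, i := by
  induction n with
  | zero => simp [majRev, descents]
  | succ n ih =>
    rw [reverse_ofFn_succ, majRev, ih]
    have hd : ∀ i, i ∈ descents f ↔ i ∈ descents (fun i : Fin n => f i.castSucc) ∨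
        i = n ∧ n ∈ descents f := by
      intro i
      by_cases hi : i = n
      · subst hi
        simp [mem_descents]
      · simp only [hi, false_and, or_false, mem_descents]
        refine and_congr_right fun _ => ⟨?_, ?_⟩
        · rintro ⟨h1, h2⟩
          exact ⟨by omega, h2⟩
        · rintro ⟨h1, h2⟩
          exact ⟨by omega, h2⟩
    have hn : n ∉ descents (fun i : Fin n => f i.castSucc) := by
      simp [mem_descents]
    by_cases h : n ∈ descents f
    · rw [if_pos ((head?_reverse_ofFn_any f).2 h)]
      have : descents f = insert n (descents (fun i : Fin n => f i.castSucc)) := by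
        ext i
        rw [hd, Finset.mem_insert]
        tauto
      rw [this, Finset.sum_insert hn]
      simp [add_comm]
    · rw [if_neg (mt (head?_reverse_ofFn_any f).1 h)]
      have : descents f = descents (fun i : Fin n => f i.castSucc) := by
        ext i
        rw [hd]
        tauto
      rw [this, add_zero]

omit [LinearOrder α] in
theorem countP_ofFn {n : ℕ} (f : Fin n → α) (p : α → Bool) :
    (List.ofFn f).countP p = ∑ i, if p (f i) then 1 else 0 := by
  induction n with
  | zero => simp
  | succ n ih => rw [List.ofFn_succ, List.countP_cons, ih, Fin.sum_univ_succ, add_comm]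

theorem inversions_ofFn {n : ℕ} (f : Fin n → α) :
    inversions (List.ofFn f) =
      (Finset.univ.filter fun p : Fin n × Fin n => p.1 < p.2 ∧ f p.2 < f p.1).card := by
  rw [Finset.card_filter, Fintype.sum_prod_type]
  induction n with
  | zero => simp [inversions]
  | succ n ih =>
    rw [List.ofFn_succ, inversions, ih, Fin.sum_univ_succ]
    congr 1
    · rw [Fin.sum_univ_succ]
      simp only [lt_self_iff_false, false_and, if_false, zero_add, Fin.succ_pos, true_and]
      simp [countP_ofFn]
    · refine Finset.sum_congr rfl fun i _ => ?_
      rw [Fin.sum_univ_succ]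
      simp

/-- The image of a word under Foata's bijection. -/
def foataFn {n : ℕ} (f : Fin n → α) : Fin n → α := fun i =>
  (foata (List.ofFn f).reverse)[(i : ℕ)]'(by simp [(foata_perm _).length_eq])

theorem ofFn_foataFn {n : ℕ} (f : Fin n → α) :
    List.ofFn (foataFn f) = foata (List.ofFn f).reverse := by
  apply List.ext_getElem
  · simp [(foata_perm _).length_eq]
  · intro i h1 h2
    simp [foataFn]

theorem foataFn_injective {n : ℕ} : Function.Injective (foataFn (α := α) (n := n)) := by
  intro f g h
  have h1 := congrArg List.ofFn h
  rw [ofFn_foataFn, ofFn_foataFn] at h1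
  exact List.ofFn_injective (List.reverse_injective (foata_injective h1))

theorem foataFn_last_lt_iff {n : ℕ} (f : Fin (n + 1) → α) :
    foataFn f (Fin.last n) < foataFn f 0 ↔ n ∈ descents f := by
  rw [← head?_reverse_ofFn_any, ← head?_foata_any_lt, ← reverse_ofFn_succ, ← ofFn_foataFn,
    List.ofFn_succ]
  have : foataFn f (Fin.last n) = f (Fin.last n) := by
    have h1 := getLast?_foata (List.ofFn f).reverse
    rw [← ofFn_foataFn, ← List.head?_reverse, reverse_ofFn_succ, reverse_ofFn_succ] at h1
    simpa using h1
  simp [this]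

/-- The content of a word, as the exponent of a monomial. -/
def weight {n : ℕ} (f : Fin n → α) : α →₀ ℕ := ∑ j, Finsupp.single (f j) 1

omit [LinearOrder α] in
theorem weight_eq_of_perm {n : ℕ} {f g : Fin n → α} (h : (List.ofFn f).Perm (List.ofFn g)) :
    weight f = weight g := by
  have e : ∀ f : Fin n → α, weight f = ((List.ofFn f).map fun a => Finsupp.single a 1).sum := by
    intro f
    rw [weight, List.map_ofFn, List.sum_ofFn]
    rfl
  rw [e, e, (h.map _).sum_eq]

theorem weight_foataFn {n : ℕ} (f : Fin n → α) : weight (foataFn f) = weight f := by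
  apply weight_eq_of_perm
  rw [ofFn_foataFn]
  exact (foata_perm _).trans (List.reverse_perm _)

omit [LinearOrder α] in
theorem finite_setOf_weight_eq {n : ℕ} (m : α →₀ ℕ) : {f : Fin n → α | weight f = m}.Finite := by
  refine (Set.Finite.pi' fun _ : Fin n => m.support.finite_toSet).subset ?_
  rintro f rfl i
  rw [Finset.mem_coe, Finsupp.mem_support_iff, weight, Finsupp.finsetSum_apply]
  have : 0 < ∑ j, (Finsupp.single (f j) 1 : α →₀ ℕ) (f i) :=
    Finset.sum_pos' (fun _ _ => Nat.zero_le _) ⟨i, Finset.mem_univ _, by simp⟩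
  exact this.ne'

/-- Foata's theorem: the major index and the number of inversions are equidistributed on the
rearrangements of a word, jointly with the conditions that the last step is a descent and that the
first letter is larger than the last one. -/
theorem ncard_maj_eq_ncard_inversions {n : ℕ} (hn : 0 < n) (m : α →₀ ℕ) (j : ℕ) (P : Prop) :
    {f : Fin n → α | weight f = m ∧ ∑ i ∈ descents f, i = j ∧ (n - 1 ∈ descents f ↔ P)}.ncard =
      {f : Fin n → α | weight f = m ∧ inversions (List.ofFn f) = j ∧
        (f ⟨n - 1, by omega⟩ < f ⟨0, hn⟩ ↔ P)}.ncard := by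
  obtain ⟨n, rfl⟩ : ∃ k, n = k + 1 := ⟨n - 1, by omega⟩
  have hfin := finite_setOf_weight_eq (n := n + 1) m
  -- Foata's map preserves weights and is injective, hence is surjective on the finite set of words
  -- of a given weight.
  have hsurj : ∀ g : Fin (n + 1) → α, weight g = m → ∃ f, weight f = m ∧ foataFn f = g := by
    intro g hg
    have himg : foataFn '' {f : Fin (n + 1) → α | weight f = m} = {f | weight f = m} := by
      refine Set.eq_of_subset_of_ncard_le ?_ ?_ hfin
      · rintro _ ⟨f, hf, rfl⟩
        exact (weight_foataFn f).trans hf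
      · rw [Set.ncard_image_of_injective _ foataFn_injective]
    have hg' : g ∈ foataFn '' {f : Fin (n + 1) → α | weight f = m} := by
      rw [himg]
      exact hg
    exact hg'
  refine Set.ncard_congr (fun f _ => foataFn f) ?_ ?_ ?_
  · rintro f ⟨h1, h2, h3⟩
    refine ⟨(weight_foataFn f).trans h1, ?_, ?_⟩
    · rw [ofFn_foataFn, inversions_foata, majRev_reverse_ofFn, h2]
    · exact (foataFn_last_lt_iff f).trans h3
  · intro f g _ _ h
    exact foataFn_injective h
  · rintro g ⟨h1, h2, h3⟩
    obtain ⟨f, hf, rfl⟩ := hsurj g h1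
    refine ⟨f, ⟨hf, ?_, ?_⟩, rfl⟩
    · rw [← majRev_reverse_ofFn, ← inversions_foata, ← ofFn_foataFn, h2]
    · exact (foataFn_last_lt_iff f).symm.trans h3

end Foata

/-! ### Standardization of words -/

section Standardization

theorem sum_ncard_fiberwise {α β : Type*} {A : Set α} (hA : A.Finite) (F : α → β) (S : Finset β) :
    ∑ s ∈ S, {a | a ∈ A ∧ F a = s}.ncard = {a | a ∈ A ∧ F a ∈ S}.ncard := by
  classical
  lift A to Finset α using hA
  have h1 : ∀ s, {a | a ∈ (A : Set α) ∧ F a = s} = ((A.filter fun a => F a = s : Finset α) : Set α) :=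
    fun s => by ext; simp
  have h2 : {a | a ∈ (A : Set α) ∧ F a ∈ S} = ((A.filter fun a => F a ∈ S : Finset α) : Set α) := by
    ext; simp
  rw [h2, Set.ncard_coe_finset, Finset.card_eq_sum_card_fiberwise (f := F) (t := S)]
  · refine Finset.sum_congr rfl fun s hs => ?_
    rw [h1, Set.ncard_coe_finset, Finset.filter_filter]
    congr 1
    ext a
    simp only [Finset.mem_filter]
    constructor
    · rintro ⟨h, rfl⟩
      exact ⟨h, hs, rfl⟩
    · rintro ⟨h, -, h'⟩
      exact ⟨h, h'⟩
  · intro a ha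
    simp at ha
    exact ha.2

variable {α : Type*} [LinearOrder α]

/-- `Tuple.sort` is stable, so `(Tuple.sort f).symm` is the standardization of `f`, with equal
letters numbered from left to right. It has the same strict inversions as `f`. -/
theorem lt_iff_sort_symm_lt {n : ℕ} (f : Fin n → α) {p q : Fin n} (h : p < q) :
    f q < f p ↔ (Tuple.sort f).symm q < (Tuple.sort f).symm p := by
  obtain ⟨h1, h2⟩ := Tuple.eq_sort_iff.1 (rfl : Tuple.sort f = Tuple.sort f)
  constructor
  · intro hlt
    by_contra hcon
    have := h1 (not_lt.1 hcon)
    simp only [Function.comp_apply, Equiv.apply_symm_apply] at this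
    exact this.not_gt hlt
  · intro hlt
    have hle := h1 hlt.le
    have h3 := h2 _ _ hlt
    simp only [Function.comp_apply, Equiv.apply_symm_apply] at hle h3
    exact lt_of_le_of_ne hle fun he => h.not_gt (h3 he)

/-- `Tuple.sort f` is the inverse of the standardization. An inversion of a permutation becomes one
of its inverse when positions and values are exchanged. -/
theorem inversions_ofFn_sort {n : ℕ} (f : Fin n → α) :
    inversions (List.ofFn (Tuple.sort f)) = inversions (List.ofFn f) := by
  rw [inversions_ofFn, inversions_ofFn]
  refine Finset.card_bij (fun p _ => (Tuple.sort f p.2, Tuple.sort f p.1)) ?_ ?_ ?_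
  · rintro ⟨p, q⟩ h
    simp only [Finset.mem_filter, Finset.mem_univ, true_and] at h ⊢
    exact ⟨h.2, (lt_iff_sort_symm_lt f h.2).2 (by simpa using h.1)⟩
  · rintro ⟨p, q⟩ _ ⟨p', q'⟩ _ h
    simpa [and_comm] using h
  · rintro ⟨p, q⟩ h
    simp only [Finset.mem_filter, Finset.mem_univ, true_and] at h
    refine ⟨((Tuple.sort f).symm q, (Tuple.sort f).symm p), ?_, by simp⟩
    simp only [Finset.mem_filter, Finset.mem_univ, true_and, Equiv.apply_symm_apply]
    exact ⟨(lt_iff_sort_symm_lt f h.1).1 h.2, h.1⟩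

/-- Translates the condition in the definition of `fundamental` into the stability condition of
`Tuple.eq_sort_iff`: `σ` has to increase along every run on which `g` is constant. -/
theorem strict_at_descents_iff {n : ℕ} (σ : Equiv.Perm (Fin n)) {g : Fin n → α} (hg : Monotone g) :
    (∀ (j : ℕ) (hj : j + 1 < n), j + 1 ∈ descents σ →
      g ⟨j, Nat.lt_of_succ_lt hj⟩ < g ⟨j + 1, hj⟩) ↔
      ∀ i j, i < j → g i = g j → σ i < σ j := by
  constructor
  · intro h
    rintro ⟨i, hi⟩ ⟨j, hj⟩ hij heq
    have hij' : i + 1 ≤ j := hij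
    clear hij
    induction j, hij' using Nat.le_induction with
    | base =>
      by_contra hcon
      refine (h i hj ?_).ne heq
      refine mem_descents.2 ⟨by omega, hj, lt_of_le_of_ne (not_lt.1 hcon) ?_⟩
      intro he
      have := σ.injective he
      simp at this
    | succ j hij ih =>
      have hj' : j < n := by omega
      have e1 : g ⟨i, hi⟩ ≤ g ⟨j, hj'⟩ := hg (Fin.mk_le_mk.2 (by omega))
      have e2 : g ⟨j, hj'⟩ ≤ g ⟨j + 1, hj⟩ := hg (Fin.mk_le_mk.2 (by omega))
      have e3 : g ⟨i, hi⟩ = g ⟨j, hj'⟩ := le_antisymm e1 (e2.trans heq.ge)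
      refine (ih hj' e3).trans ?_
      by_contra hcon
      refine (h j hj ?_).ne (e3.symm.trans heq)
      refine mem_descents.2 ⟨by omega, hj, lt_of_le_of_ne (not_lt.1 hcon) ?_⟩
      intro he
      have := σ.injective he
      simp at this
  · intro h j hj hd
    refine lt_of_le_of_ne (hg (Fin.mk_le_mk.2 (by omega))) fun he => ?_
    obtain ⟨_, _, hlt⟩ := mem_descents.1 hd
    exact (h ⟨j, Nat.lt_of_succ_lt hj⟩ ⟨j + 1, hj⟩ (Fin.mk_lt_mk.2 (by omega)) he).not_gt hlt

omit [LinearOrder α] in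
theorem weight_comp_perm {n : ℕ} (f : Fin n → α) (σ : Equiv.Perm (Fin n)) :
    weight (f ∘ σ) = weight f :=
  Equiv.sum_comp σ fun j => Finsupp.single (f j) 1

/-- The coefficients of a fundamental quasisymmetric function count the words with a given
standardization. -/
theorem fundamental_descents_apply {n : ℕ} (σ : Equiv.Perm (Fin n)) (m : ℕ+ →₀ ℕ) :
    fundamental n (descents σ) m =
      ({f : Fin n → ℕ+ | weight f = m ∧ Tuple.sort f = σ}.ncard : ℤ) := by
  rw [fundamental]
  congr 1
  refine Set.ncard_congr (fun g _ => g ∘ σ.symm) ?_ ?_ ?_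
  · rintro g ⟨h1, h2, h3⟩
    refine ⟨(weight_comp_perm g σ.symm).trans h3, ?_⟩
    refine (Tuple.eq_sort_iff.2 ?_).symm
    rw [Function.comp_assoc, Equiv.symm_comp_self, Function.comp_id]
    simp only [Function.comp_apply, Equiv.symm_apply_apply]
    exact ⟨h1, (strict_at_descents_iff σ h1).1 h2⟩
  · intro f g _ _ h
    exact σ.symm.surjective.injective_comp_right h
  · rintro f ⟨h1, h2⟩
    obtain ⟨h3, h4⟩ := Tuple.eq_sort_iff.1 h2.symm
    refine ⟨f ∘ σ, ⟨h3, (strict_at_descents_iff σ h3).2 h4, ?_⟩, ?_⟩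
    · exact (weight_comp_perm f σ).trans h1
    · rw [Function.comp_assoc, Equiv.self_comp_symm, Function.comp_id]

/-- Groups words by their sorting permutation. Both conditions on `σ` can be read off from the word
itself, since standardization keeps strict inversions. -/
theorem sum_fundamental_descents_apply {n : ℕ} (hn : 0 < n) (j : ℕ) (P : Prop)
    (S : Finset (Equiv.Perm (Fin n)))
    (hS : ∀ σ, σ ∈ S ↔ inversions (List.ofFn σ) = j ∧
      (σ.symm ⟨n - 1, by omega⟩ < σ.symm ⟨0, hn⟩ ↔ P)) (m : ℕ+ →₀ ℕ) :
    ∑ σ ∈ S, fundamental n (descents σ) m =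
      ({f : Fin n → ℕ+ | weight f = m ∧ inversions (List.ofFn f) = j ∧
        (f ⟨n - 1, by omega⟩ < f ⟨0, hn⟩ ↔ P)}.ncard : ℤ) := by
  simp only [fundamental_descents_apply]
  rw [← Nat.cast_sum]
  congr 1
  refine (sum_ncard_fiberwise (finite_setOf_weight_eq m) Tuple.sort S).trans ?_
  congr 1
  ext f
  refine and_congr_right fun _ => ?_
  rw [hS, inversions_ofFn_sort]
  refine and_congr_right fun _ => ?_
  -- For `n = 1` the first and the last position coincide, and both strict inequalities are false.
  rcases Nat.eq_zero_or_pos (n - 1) with h | h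
  · have : (⟨n - 1, by omega⟩ : Fin n) = ⟨0, hn⟩ := Fin.ext h
    rw [this]
    simp
  · rw [lt_iff_sort_symm_lt f (p := ⟨0, hn⟩) (q := ⟨n - 1, by omega⟩) (Fin.mk_lt_mk.2 h)]

end Standardization

/-! ### Ribbons and their descent sets -/

section Ribbons

/-- The cells `c 0, …, c (n - 1)` form a lattice path from northwest to southeast that traverses
`ν`; the step from `c (i - 1)` to `c i` goes south if `i ∈ D` and east otherwise. -/
structure IsRibbonPath (n : ℕ) (D : Finset ℕ) (c : ℕ → ℕ × ℕ) (ν : Finset (ℕ × ℕ)) : Prop where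
  image_eq : (Finset.range n).image c = ν
  south : ∀ i, i + 1 < n → i + 1 ∈ D → (c (i + 1)).2 = (c i).2 ∧ (c (i + 1)).1 + 1 = (c i).1
  east : ∀ i, i + 1 < n → i + 1 ∉ D → (c (i + 1)).1 = (c i).1 ∧ (c (i + 1)).2 = (c i).2 + 1
  subset : D ⊆ Finset.Icc 1 (n - 1)

variable {n : ℕ} {D : Finset ℕ} {c : ℕ → ℕ × ℕ} {ν : Finset (ℕ × ℕ)}

theorem IsRibbonPath.mem (h : IsRibbonPath n D c ν) {i : ℕ} (hi : i < n) : c i ∈ ν := by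
  rw [← h.image_eq]
  exact Finset.mem_image_of_mem c (Finset.mem_range.2 hi)

theorem IsRibbonPath.exists_eq (h : IsRibbonPath n D c ν) {x : ℕ × ℕ} (hx : x ∈ ν) :
    ∃ i < n, c i = x := by
  rw [← h.image_eq] at hx
  simpa using hx

theorem IsRibbonPath.content_eq (h : IsRibbonPath n D c ν) {i : ℕ} (hi : i < n) :
    content (c i) = content (c 0) + i := by
  induction i with
  | zero => simp
  | succ i ih =>
    have ih := ih (by omega)
    unfold content at ih ⊢
    by_cases hd : i + 1 ∈ D
    · have := h.south i hi hd
      push_cast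
      omega
    · have := h.east i hi hd
      push_cast
      omega

theorem IsRibbonPath.index_inj (h : IsRibbonPath n D c ν) {i j : ℕ} (hi : i < n) (hj : j < n)
    (he : content (c i) = content (c j)) : i = j := by
  rw [h.content_eq hi, h.content_eq hj] at he
  omega

theorem IsRibbonPath.antitone_row (h : IsRibbonPath n D c ν) {i j : ℕ} (hij : i ≤ j) (hj : j < n) :
    (c j).1 ≤ (c i).1 := by
  induction j, hij using Nat.le_induction with
  | base => exact le_rfl
  | succ j hij ih =>
    have ih := ih (by omega)
    by_cases hd : j + 1 ∈ D
    · have := h.south j hj hd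
      omega
    · have := h.east j hj hd
      omega

theorem IsRibbonPath.monotone_col (h : IsRibbonPath n D c ν) {i j : ℕ} (hij : i ≤ j) (hj : j < n) :
    (c i).2 ≤ (c j).2 := by
  induction j, hij using Nat.le_induction with
  | base => exact le_rfl
  | succ j hij ih =>
    have ih := ih (by omega)
    by_cases hd : j + 1 ∈ D
    · have := h.south j hj hd
      omega
    · have := h.east j hj hd
      omega

theorem IsRibbonPath.injOn (h : IsRibbonPath n D c ν) : Set.InjOn c (Finset.range n) := by
  intro i hi j hj hij
  simp only [Finset.coe_range, Set.mem_Iio] at hi hj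
  exact h.index_inj hi hj (by rw [hij])

theorem IsRibbonPath.card_eq (h : IsRibbonPath n D c ν) : ν.card = n := by
  rw [← h.image_eq, Finset.card_image_of_injOn h.injOn, Finset.card_range]

theorem IsRibbonPath.ribbonLabel_eq (h : IsRibbonPath n D c ν) {i : ℕ} (hi : i < n) :
    ribbonLabel ν (c i) = i + 1 := by
  have : ν.filter (fun y => content y ≤ content (c i)) = (Finset.range (i + 1)).image c := by
    ext y
    simp only [Finset.mem_filter, Finset.mem_image, Finset.mem_range]
    constructor
    · rintro ⟨hy, hle⟩
      obtain ⟨j, hj, rfl⟩ := h.exists_eq hy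
      rw [h.content_eq hi, h.content_eq hj] at hle
      exact ⟨j, by omega, rfl⟩
    · rintro ⟨j, hj, rfl⟩
      refine ⟨h.mem (by omega), ?_⟩
      rw [h.content_eq hi, h.content_eq (by omega)]
      omega
  rw [ribbonLabel, this, Finset.card_image_of_injOn, Finset.card_range]
  exact h.injOn.mono (by
    intro j hj
    simp at hj ⊢
    omega)

theorem IsRibbonPath.ribbonDes_eq (h : IsRibbonPath n D c ν) : ribbonDes ν = D := by
  ext i
  rw [ribbonDes, Finset.mem_filter, h.card_eq, Finset.mem_Icc]
  constructor
  · rintro ⟨⟨h1, h2⟩, x, hx, y, hy, lx, ly, hcol, hrow⟩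
    obtain ⟨a, ha, rfl⟩ := h.exists_eq hx
    obtain ⟨b, hb, rfl⟩ := h.exists_eq hy
    rw [h.ribbonLabel_eq ha] at lx
    rw [h.ribbonLabel_eq hb] at ly
    subst lx
    obtain rfl : b = a + 1 := by omega
    by_contra hd
    have := h.east a hb hd
    omega
  · intro hi
    have := Finset.mem_Icc.1 (h.subset hi)
    obtain ⟨a, rfl⟩ : ∃ a, i = a + 1 := ⟨i - 1, by omega⟩
    have ha : a + 1 < n := by omega
    have hs := h.south a ha hi
    exact ⟨this, c a, h.mem (by omega), c (a + 1), h.mem ha, h.ribbonLabel_eq (by omega),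
      h.ribbonLabel_eq ha, hs.1, by omega⟩

theorem IsRibbonPath.first_col_eq_zero (h : IsRibbonPath n D c ν) (hν : IsNormalized ν) :
    (c 0).2 = 0 := by
  obtain ⟨r, hr⟩ := hν.2
  obtain ⟨i, hi, he⟩ := h.exists_eq hr
  have := h.monotone_col (Nat.zero_le i) hi
  rw [he] at this
  exact Nat.le_zero.1 this

theorem IsRibbonPath.last_row_eq_zero (h : IsRibbonPath n D c ν) (hν : IsNormalized ν) :
    (c (n - 1)).1 = 0 := by
  obtain ⟨r, hr⟩ := hν.1
  obtain ⟨i, hi, he⟩ := h.exists_eq hr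
  have := h.antitone_row (i := i) (j := n - 1) (by omega) (by omega)
  rw [he] at this
  exact Nat.le_zero.1 this

/-- The descent set fixes the path up to translation. Normalization fixes the translation, because
the path starts in its westernmost column and ends in its southernmost row. -/
theorem IsRibbonPath.unique {c' : ℕ → ℕ × ℕ} {ν' : Finset (ℕ × ℕ)} (h : IsRibbonPath n D c ν)
    (h' : IsRibbonPath n D c' ν') (hν : IsNormalized ν) (hν' : IsNormalized ν') : ν = ν' := by
  have key : ∀ i < n, (c i).2 = (c' i).2 ∧ (c i).1 + (c' 0).1 = (c' i).1 + (c 0).1 := by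
    intro i hi
    induction i with
    | zero => exact ⟨(h.first_col_eq_zero hν).trans (h'.first_col_eq_zero hν').symm, add_comm _ _⟩
    | succ i ih =>
      have ih := ih (by omega)
      by_cases hd : i + 1 ∈ D
      · have := h.south i hi hd
        have := h'.south i hi hd
        omega
      · have := h.east i hi hd
        have := h'.east i hi hd
        omega
  rw [← h.image_eq, ← h'.image_eq]
  refine Finset.image_congr fun i hi => ?_
  simp only [Finset.coe_range, Set.mem_Iio] at hi
  have h1 := key i hi
  have h2 := key (n - 1) (by omega)
  rw [h.last_row_eq_zero hν, h'.last_row_eq_zero hν'] at h2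
  exact Prod.ext (by omega) h1.1

/-! #### Ribbons are lattice paths -/

theorem SkewShape.mem_cells_of_le_of_le (s : SkewShape) {x y z : ℕ × ℕ} (hx : x ∈ s.cells)
    (hy : y ∈ s.cells) (hxz : x ≤ z) (hzy : z ≤ y) : z ∈ s.cells := by
  simp only [SkewShape.cells, Finset.mem_sdiff] at hx hy ⊢
  exact ⟨s.outer.isLowerSet hzy hy.1, fun hz => hx.2 (s.inner.isLowerSet hxz hz)⟩

/-- A skew diagram is convex for the product order, so two cells on one diagonal would force a 2 × 2
block at the lower one. -/
theorem IsRibbon.eq_of_content_eq (hν : IsRibbon ν) {x y : ℕ × ℕ} (hx : x ∈ ν) (hy : y ∈ ν)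
    (h : content x = content y) : x = y := by
  obtain ⟨s, rfl⟩ := hν.skew
  have key : ∀ x y : ℕ × ℕ, x ∈ s.cells → y ∈ s.cells → content x = content y → ¬ x.1 < y.1 := by
    rintro ⟨r, c⟩ ⟨r', c'⟩ hx hy h hlt
    simp only [content] at h hlt
    refine hν.no_block r c ⟨hx, ?_, ?_, ?_⟩ <;>
      exact s.mem_cells_of_le_of_le hx hy (Prod.mk_le_mk.2 (by omega))
        (Prod.mk_le_mk.2 (by omega))
  have h1 := key x y hx hy h
  have h2 := key y x hy hx h.symm
  unfold content at h
  exact Prod.ext (by omega) (by omega)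

/-- A discrete intermediate value argument: along an edge the content changes by exactly one, so a
connecting path must step from `a` to `a + 1`. -/
theorem IsRibbon.exists_step (hν : IsRibbon ν) {x y : ℕ × ℕ} (hx : x ∈ ν) (hy : y ∈ ν) {a : ℤ}
    (ha : content x ≤ a) (ha' : a < content y) :
    ∃ u ∈ ν, ∃ v ∈ ν, content u = a ∧ content v = a + 1 ∧ EdgeAdj u v := by
  have h := hν.connected x hx y hy
  induction h with
  | refl => omega
  | @tail u v huv hv ih =>
    have hu : u ∈ ν := by
      rcases Relation.ReflTransGen.cases_tail huv with rfl | ⟨w, -, hw⟩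
      · exact hx
      · exact hw.1
    by_cases hau : a < content u
    · exact ih hu hau
    · refine ⟨u, hu, v, hv.1, ?_, ?_, hv.2⟩ <;>
      · have := hv.2
        unfold EdgeAdj content at *
        omega

/-- The contents of the cells are distinct and fill an interval, so the cells can be listed by
content. Consecutive cells are adjacent by `IsRibbon.exists_step`, and an edge that raises the
content goes south or east. -/
theorem IsRibbon.exists_isRibbonPath (hν : IsRibbon ν) (hn : 0 < ν.card) :
    ∃ D c, IsRibbonPath ν.card D c ν := by
  classical
  obtain ⟨x0, hx0, hmin⟩ := ν.exists_min_image content (Finset.card_pos.1 hn)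
  obtain ⟨y0, hy0, hmax⟩ := ν.exists_max_image content (Finset.card_pos.1 hn)
  have hinj : Set.InjOn content (ν : Set (ℕ × ℕ)) := fun x hx y hy => hν.eq_of_content_eq hx hy
  have himg : ν.image content = Finset.Icc (content x0) (content y0) := by
    ext a
    rw [Finset.mem_image, Finset.mem_Icc]
    constructor
    · rintro ⟨x, hx, rfl⟩
      exact ⟨hmin x hx, hmax x hx⟩
    · rintro ⟨h1, h2⟩
      rcases h2.eq_or_lt with rfl | h2
      · exact ⟨y0, hy0, rfl⟩
      · obtain ⟨u, hu, -, -, h, -⟩ := hν.exists_step hx0 hy0 h1 h2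
        exact ⟨u, hu, h⟩
  have hcard : (ν.card : ℤ) = content y0 - content x0 + 1 := by
    have := congrArg Finset.card himg
    rw [Finset.card_image_of_injOn hinj, Int.card_Icc] at this
    have := hmin y0 hy0
    omega
  have hex : ∀ i : ℕ, ∃ x, i < ν.card → x ∈ ν ∧ content x = content x0 + i := by
    intro i
    by_cases hi : i < ν.card
    · have : content x0 + i ∈ ν.image content := by
        rw [himg, Finset.mem_Icc]
        omega
      obtain ⟨x, hx, he⟩ := Finset.mem_image.1 this
      exact ⟨x, fun _ => ⟨hx, he⟩⟩
    · exact ⟨(0, 0), fun h => absurd h hi⟩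
  choose c hc using hex
  have hstep : ∀ i, i + 1 < ν.card → EdgeAdj (c i) (c (i + 1)) := by
    intro i hi
    obtain ⟨h1, h2⟩ := hc i (by omega)
    obtain ⟨h3, h4⟩ := hc (i + 1) hi
    obtain ⟨u, hu, v, hv, hcu, hcv, hadj⟩ := hν.exists_step h1 h3 (a := content (c i)) le_rfl
      (by push_cast at h4; omega)
    rwa [hν.eq_of_content_eq h1 hu hcu.symm, hν.eq_of_content_eq h3 hv
      (by push_cast at h4; omega)]
  refine ⟨(Finset.Icc 1 (ν.card - 1)).filter fun i => (c i).2 = (c (i - 1)).2, c, ?_, ?_, ?_,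
    Finset.filter_subset _ _⟩
  · ext x
    rw [Finset.mem_image]
    constructor
    · rintro ⟨i, hi, rfl⟩
      exact (hc i (Finset.mem_range.1 hi)).1
    · intro hx
      have h1 := hmin x hx
      have h2 := hmax x hx
      have hi : (content x - content x0).toNat < ν.card := by omega
      obtain ⟨h3, h4⟩ := hc _ hi
      exact ⟨_, Finset.mem_range.2 hi, hν.eq_of_content_eq h3 hx (by omega)⟩
  · intro i hi hd
    have h1 := (Finset.mem_filter.1 hd).2
    have h2 := hstep i hi
    have h3 := (hc i (by omega)).2
    have h4 := (hc (i + 1) hi).2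
    simp only [Nat.add_sub_cancel] at h1
    unfold EdgeAdj at h2
    unfold content at h3 h4
    omega
  · intro i hi hd
    have h1 : (c (i + 1)).2 ≠ (c i).2 := by
      intro he
      exact hd (Finset.mem_filter.2 ⟨Finset.mem_Icc.2 (by omega), he⟩)
    have h2 := hstep i hi
    have h3 := (hc i (by omega)).2
    have h4 := (hc (i + 1) hi).2
    unfold EdgeAdj at h2
    unfold content at h3 h4
    omega

/-! #### The ribbon with a given descent set -/

/-- A normalized path runs from the first column to the first row, so it meets the diagonal of every
cell weakly southwest of it. The path cell on the diagonal of `z` can lie neither strictly northeast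
of `z`, by `hz'`, nor strictly southwest of it, as the path is monotone. -/
theorem IsRibbonPath.mem_of_le (h : IsRibbonPath n D c ν) (hν : IsNormalized ν) {z : ℕ × ℕ} {j : ℕ}
    (hj : j < n) (hz : z ≤ c j) (hz' : ∀ i < n, ¬ (z.1 + 1, z.2 + 1) ≤ c i) : z ∈ ν := by
  have h0 := h.first_col_eq_zero hν
  have h1 := h.last_row_eq_zero hν
  have h2 := h.antitone_row (Nat.zero_le j) hj
  have h3 := h.monotone_col (i := j) (j := n - 1) (by omega) (by omega)
  have h4 := h.content_eq (i := n - 1) (by omega)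
  obtain ⟨hz1, hz2⟩ := Prod.le_def.1 hz
  obtain ⟨i, hi, hci⟩ : ∃ i < n, content (c i) = content z := by
    refine ⟨(content z - content (c 0)).toNat, ?_, ?_⟩
    · unfold content at *
      omega
    · rw [h.content_eq]
      · unfold content
        omega
      · unfold content at *
        omega
  have h5 := hz' i hi
  rw [Prod.le_def] at h5
  simp only at h5
  suffices z = c i by
    rw [this]
    exact h.mem hi
  have h6 : (c i).1 ≤ z.1 := by
    unfold content at hci
    omega
  have h7 : ¬ (c i).1 < z.1 := by
    intro hlt
    unfold content at hci
    rcases le_total i j with hij | hij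
    · have := h.antitone_row hij hj
      omega
    · have := h.monotone_col hij hi
      omega
  unfold content at hci
  exact Prod.ext (by omega) (by omega)

/-- The outer diagram consists of all cells weakly southwest of the path. The inner one consists of
those whose northeast diagonal neighbour is still in the outer diagram, so the difference is the
outer rim, which is the path. -/
theorem IsRibbonPath.exists_skewShape (h : IsRibbonPath n D c ν) (hν : IsNormalized ν) :
    ∃ s : SkewShape, s.cells = ν := by
  classical
  let outer : YoungDiagram :=
    { cells := ν.biUnion fun x => Finset.Iic x
      isLowerSet := by
        intro x y hyx hx
        simp only [Finset.coe_biUnion, Set.mem_iUnion, Finset.coe_Iic, Set.mem_Iic] at hx ⊢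
        obtain ⟨z, hz, hxz⟩ := hx
        exact ⟨z, hz, hyx.trans hxz⟩ }
  have hout : ∀ x, x ∈ outer.cells ↔ ∃ z ∈ ν, x ≤ z := by
    intro x
    simp [outer]
  let inner : YoungDiagram :=
    { cells := outer.cells.filter fun x => (x.1 + 1, x.2 + 1) ∈ outer.cells
      isLowerSet := by
        intro x y hyx hx
        simp only [Finset.mem_coe, Finset.mem_filter, hout] at hx ⊢
        obtain ⟨⟨z, hz, hxz⟩, w, hw, hxw⟩ := hx
        refine ⟨⟨z, hz, hyx.trans hxz⟩, w, hw, le_trans ?_ hxw⟩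
        obtain ⟨h1, h2⟩ := Prod.le_def.1 hyx
        exact Prod.mk_le_mk.2 ⟨by omega, by omega⟩ }
  have hin : ∀ x, x ∈ inner.cells ↔ x ∈ outer.cells ∧ (x.1 + 1, x.2 + 1) ∈ outer.cells := by
    intro x
    simp [inner]
  refine ⟨⟨outer, inner, Finset.filter_subset _ _⟩, ?_⟩
  ext z
  simp only [SkewShape.cells, Finset.mem_sdiff, hin, not_and]
  constructor
  · rintro ⟨h1, h2⟩
    have h2 := h2 h1
    rw [hout] at h1 h2
    obtain ⟨x, hx, hzx⟩ := h1
    obtain ⟨j, hj, rfl⟩ := h.exists_eq hx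
    exact h.mem_of_le hν hj hzx fun i hi hle => h2 ⟨c i, h.mem hi, hle⟩
  · intro hz
    refine ⟨(hout z).2 ⟨z, hz, le_rfl⟩, fun _ hcon => ?_⟩
    obtain ⟨w, hw, hle⟩ := (hout _).1 hcon
    obtain ⟨i, hi, rfl⟩ := h.exists_eq hz
    obtain ⟨j, hj, rfl⟩ := h.exists_eq hw
    obtain ⟨h1, h2⟩ := Prod.le_def.1 hle
    simp only at h1 h2
    rcases le_total i j with hij | hij
    · have := h.antitone_row hij hj
      omega
    · have := h.monotone_col hij hi
      omega

theorem EdgeAdj.symm {x y : ℕ × ℕ} (h : EdgeAdj x y) : EdgeAdj y x := by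
  unfold EdgeAdj at *
  omega

theorem IsRibbonPath.edgeAdj (h : IsRibbonPath n D c ν) {i : ℕ} (hi : i + 1 < n) :
    EdgeAdj (c i) (c (i + 1)) := by
  unfold EdgeAdj
  by_cases hd : i + 1 ∈ D
  · have := h.south i hi hd
    omega
  · have := h.east i hi hd
    omega

theorem IsRibbonPath.isRibbon (h : IsRibbonPath n D c ν) (hν : IsNormalized ν) : IsRibbon ν where
  skew := h.exists_skewShape hν
  connected := by
    have key : ∀ i j, i ≤ j → j < n →
        Relation.ReflTransGen (fun a b => b ∈ ν ∧ EdgeAdj a b) (c i) (c j) ∧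
        Relation.ReflTransGen (fun a b => b ∈ ν ∧ EdgeAdj a b) (c j) (c i) := by
      intro i j hij hj
      induction j, hij using Nat.le_induction with
      | base => exact ⟨.refl, .refl⟩
      | succ j hij ih =>
        obtain ⟨h1, h2⟩ := ih (by omega)
        exact ⟨h1.tail ⟨h.mem hj, h.edgeAdj hj⟩,
          Relation.ReflTransGen.head ⟨h.mem (by omega), (h.edgeAdj hj).symm⟩ h2⟩
    intro x hx y hy
    obtain ⟨i, hi, rfl⟩ := h.exists_eq hx
    obtain ⟨j, hj, rfl⟩ := h.exists_eq hy
    rcases le_total i j with hij | hij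
    · exact (key i j hij hj).1
    · exact (key j i hij hi).2
  no_block := by
    rintro r k ⟨h1, -, -, h2⟩
    obtain ⟨i, hi, hi'⟩ := h.exists_eq h1
    obtain ⟨j, hj, hj'⟩ := h.exists_eq h2
    have := h.index_inj hi hj (by rw [hi', hj']; simp [content])
    rw [this, hj'] at hi'
    simp at hi'

theorem exists_ribbon_of_descents (hn : 0 < n) (hD : D ⊆ Finset.Icc 1 (n - 1)) :
    ∃ ν c, IsRibbonPath n D c ν ∧ IsNormalized ν := by
  classical
  -- The row of the cell `c i` counts the south steps still to come, its column the east steps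
  -- already made; this normalizes the ribbon.
  let c : ℕ → ℕ × ℕ := fun i => ((D.filter fun d => i < d).card,
    ((Finset.Icc 1 i).filter fun d => d ∉ D).card)
  refine ⟨(Finset.range n).image c, c, ⟨rfl, ?_, ?_, hD⟩, ⟨(c (n - 1)).2, ?_⟩, ⟨(c 0).1, ?_⟩⟩
  · intro i hi hd
    have h1 : (D.filter fun d => i < d) = insert (i + 1) (D.filter fun d => i + 1 < d) := by
      ext d
      simp only [Finset.mem_filter, Finset.mem_insert]
      constructor
      · rintro ⟨h1, h2⟩
        by_cases h : d = i + 1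
        · exact .inl h
        · exact .inr ⟨h1, by omega⟩
      · rintro (rfl | ⟨h1, h2⟩)
        · exact ⟨hd, by omega⟩
        · exact ⟨h1, by omega⟩
    have h2 : (Finset.Icc 1 (i + 1)).filter (fun d => d ∉ D) =
        (Finset.Icc 1 i).filter fun d => d ∉ D := by
      rw [← Finset.insert_Icc_right_eq_Icc_add_one (by omega), Finset.filter_insert,
        if_neg (by simpa using hd)]
    refine ⟨by simp only [c, h2], ?_⟩
    simp only [c, h1]
    rw [Finset.card_insert_of_notMem (by simp)]
  · intro i hi hd
    have h1 : (D.filter fun d => i < d) = (D.filter fun d => i + 1 < d) := by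
      refine Finset.filter_congr fun d hd' => ?_
      have : d ≠ i + 1 := by
        rintro rfl
        exact hd hd'
      omega
    have h2 : (Finset.Icc 1 (i + 1)).filter (fun d => d ∉ D) =
        insert (i + 1) ((Finset.Icc 1 i).filter fun d => d ∉ D) := by
      rw [← Finset.insert_Icc_right_eq_Icc_add_one (by omega), Finset.filter_insert, if_pos hd]
    refine ⟨by simp only [c, h1], ?_⟩
    simp only [c, h2]
    rw [Finset.card_insert_of_notMem (by simp)]
  · refine Finset.mem_image.2 ⟨n - 1, Finset.mem_range.2 (by omega), Prod.ext ?_ rfl⟩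
    simp only [c]
    rw [Finset.card_eq_zero, Finset.filter_eq_empty_iff]
    intro d hd
    have := Finset.mem_Icc.1 (hD hd)
    omega
  · exact Finset.mem_image.2 ⟨0, Finset.mem_range.2 hn, Prod.ext rfl (by simp [c])⟩

/-! #### Semistandard fillings of ribbons are words with a given descent set -/

/-- In the French convention an east step must weakly increase the entry and a south step must
strictly decrease it. The inequalities between distant cells of a row or column follow by
transitivity along the path. -/
theorem IsRibbonPath.isSSYT_iff (h : IsRibbonPath n D c ν) (T : ν → ℕ+) :
    IsSSYT ν T ↔ descents (fun i : Fin n => T ⟨c i, h.mem i.2⟩) = D := by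
  constructor
  · rintro ⟨h1, h2⟩
    ext i
    rw [mem_descents]
    constructor
    · rintro ⟨hi, hin, hlt⟩
      obtain ⟨i, rfl⟩ : ∃ a, i = a + 1 := ⟨i - 1, by omega⟩
      by_contra hd
      have he := h.east i hin hd
      exact hlt.not_ge (h1 ⟨c i, h.mem (by omega)⟩ ⟨c (i + 1), h.mem hin⟩ he.1.symm
        (by simp only; omega))
    · intro hd
      have := Finset.mem_Icc.1 (h.subset hd)
      obtain ⟨i, rfl⟩ : ∃ a, i = a + 1 := ⟨i - 1, by omega⟩
      have hin : i + 1 < n := by omega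
      have he := h.south i hin hd
      exact ⟨by omega, hin, h2 ⟨c (i + 1), h.mem hin⟩ ⟨c i, h.mem (by omega)⟩ he.1
        (by simp only; omega)⟩
  · intro hD
    have hrow : ∀ i j (hij : i ≤ j) (hj : j < n), (c i).1 = (c j).1 →
        T ⟨c i, h.mem (hij.trans_lt hj)⟩ ≤ T ⟨c j, h.mem hj⟩ := by
      intro i j hij hj he
      induction j, hij using Nat.le_induction with
      | base => exact le_rfl
      | succ j hij ih =>
        have h1 := h.antitone_row (show j ≤ j + 1 by omega) hj
        have h2 := h.antitone_row hij (show j < n by omega)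
        refine (ih (by omega) (by omega)).trans ?_
        have hd : j + 1 ∉ D := fun hd => by
          have := h.south j hj hd
          omega
        rw [← hD, mem_descents] at hd
        by_contra hlt
        exact hd ⟨by omega, hj, not_le.1 hlt⟩
    have hcol : ∀ i j (hij : i + 1 ≤ j) (hj : j < n), (c i).2 = (c j).2 →
        T ⟨c j, h.mem hj⟩ < T ⟨c i, h.mem (by omega)⟩ := by
      have hstep : ∀ j (hj : j + 1 < n), (c j).2 = (c (j + 1)).2 →
          T ⟨c (j + 1), h.mem hj⟩ < T ⟨c j, h.mem (by omega)⟩ := by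
        intro j hj he
        have hd : j + 1 ∈ D := by
          by_contra hd
          have := h.east j hj hd
          omega
        rw [← hD, mem_descents] at hd
        exact hd.2.2
      intro i j hij hj he
      induction j, hij using Nat.le_induction with
      | base => exact hstep i hj he
      | succ j hij ih =>
        have h1 := h.monotone_col (show j ≤ j + 1 by omega) hj
        have h2 := h.monotone_col (show i ≤ j by omega) (show j < n by omega)
        exact (hstep j hj (by omega)).trans (ih (by omega) (by omega))
    constructor
    · rintro ⟨x, hx⟩ ⟨y, hy⟩ hr hc
      obtain ⟨i, hi, rfl⟩ := h.exists_eq hx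
      obtain ⟨j, hj, rfl⟩ := h.exists_eq hy
      have h1 := h.content_eq hi
      have h2 := h.content_eq hj
      simp only at hr hc
      exact hrow i j (by unfold content at h1 h2; omega) hj hr
    · rintro ⟨x, hx⟩ ⟨y, hy⟩ hc hr
      obtain ⟨i, hi, rfl⟩ := h.exists_eq hx
      obtain ⟨j, hj, rfl⟩ := h.exists_eq hy
      have h1 := h.content_eq hi
      have h2 := h.content_eq hj
      simp only at hr hc
      exact hcol j i (by unfold content at h1 h2; omega) hi hc.symm

theorem IsRibbonPath.schur_apply (h : IsRibbonPath n D c ν) (m : ℕ+ →₀ ℕ) :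
    schur ν m = ({f : Fin n → ℕ+ | weight f = m ∧ descents f = D}.ncard : ℤ) := by
  let e : Fin n ≃ ν := Equiv.ofBijective (fun i => ⟨c i, h.mem i.2⟩) (by
    constructor
    · intro i j hij
      exact Fin.ext (h.index_inj i.2 j.2 (congrArg (fun x => content x.1) hij))
    · rintro ⟨x, hx⟩
      obtain ⟨i, hi, rfl⟩ := h.exists_eq hx
      exact ⟨⟨i, hi⟩, rfl⟩)
  have hw : ∀ T : ν → ℕ+, weight (T ∘ e) = ∑ x, Finsupp.single (T x) 1 := fun T =>
    Equiv.sum_comp e fun x => Finsupp.single (T x) 1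
  rw [schur]
  congr 1
  refine Set.ncard_congr (fun T _ => T ∘ e) ?_ ?_ ?_
  · rintro T ⟨h1, h2⟩
    exact ⟨(hw T).trans h2, (h.isSSYT_iff T).1 h1⟩
  · intro T T' _ _ he
    exact e.surjective.injective_comp_right he
  · rintro f ⟨h1, h2⟩
    have hf : (f ∘ e.symm) ∘ e = f := by
      rw [Function.comp_assoc, Equiv.symm_comp_self, Function.comp_id]
    refine ⟨f ∘ e.symm, ⟨(h.isSSYT_iff _).2 ?_, ?_⟩, hf⟩
    · exact (congrArg descents hf).trans h2
    · rw [← hw, hf, h1]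

theorem descents_subset {α : Type*} [LinearOrder α] (f : Fin n → α) :
    descents f ⊆ Finset.Icc 1 (n - 1) := Finset.filter_subset _ _

/-- The coefficients of a sum of ribbon Schur functions count words by major index. -/
theorem ribbonSum_apply (hn : 0 < n) (j : ℕ) (P : Prop) (m : ℕ+ →₀ ℕ) :
    ribbonSum n j P m = ({f : Fin n → ℕ+ | weight f = m ∧ ∑ i ∈ descents f, i = j ∧
      (n - 1 ∈ descents f ↔ P)}.ncard : ℤ) := by
  classical
  have hpath : ∀ ν ∈ ribbons n, ∃ c, IsRibbonPath n (ribbonDes ν) c ν := by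
    intro ν hν
    obtain ⟨h1, h2, h3⟩ := mem_ribbons.1 hν
    obtain ⟨D, c, h⟩ := h1.exists_isRibbonPath (by omega)
    rw [h3] at h
    exact ⟨c, by rwa [h.ribbonDes_eq]⟩
  have hinj : Set.InjOn ribbonDes (ribbons n : Set (Finset (ℕ × ℕ))) := by
    intro ν hν ν' hν' he
    obtain ⟨c, h⟩ := hpath ν hν
    obtain ⟨c', h'⟩ := hpath ν' hν'
    rw [← he] at h'
    exact h.unique h' (mem_ribbons.1 hν).2.1 (mem_ribbons.1 hν').2.1
  set S := (ribbons n).filter (fun ν => ribbonMaj ν = j ∧ (n - 1 ∈ ribbonDes ν ↔ P)) with hS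
  have e1 : ribbonSum n j P m = ∑ ν ∈ S, schur ν m := by
    rw [ribbonSum]
    exact map_sum (MvPowerSeries.coeff m) _ _
  have e2 : ∑ ν ∈ S, schur ν m = ∑ ν ∈ S,
      ({f : Fin n → ℕ+ | weight f = m ∧ descents f = ribbonDes ν}.ncard : ℤ) := by
    refine Finset.sum_congr rfl fun ν hν => ?_
    obtain ⟨c, h⟩ := hpath ν (Finset.mem_filter.1 hν).1
    exact h.schur_apply m
  have e3 : ∑ ν ∈ S, {f : Fin n → ℕ+ | weight f = m ∧ descents f = ribbonDes ν}.ncard =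
      ∑ D ∈ S.image ribbonDes, {f : Fin n → ℕ+ | weight f = m ∧ descents f = D}.ncard := by
    rw [Finset.sum_image]
    exact hinj.mono (Finset.coe_subset.2 (Finset.filter_subset _ _))
  rw [e1, e2, ← Nat.cast_sum, e3]
  congr 1
  refine (sum_ncard_fiberwise (finite_setOf_weight_eq m) descents _).trans ?_
  congr 1
  ext f
  refine and_congr_right fun _ => ?_
  rw [Finset.mem_image]
  constructor
  · rintro ⟨ν, hν, he⟩
    rw [← he]
    exact (Finset.mem_filter.1 hν).2
  · intro hf
    obtain ⟨ν, c, h, hν⟩ := exists_ribbon_of_descents hn (descents_subset f)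
    refine ⟨ν, Finset.mem_filter.2 ⟨mem_ribbons.2 ⟨h.isRibbon hν, hν, h.card_eq⟩, ?_⟩,
      h.ribbonDes_eq⟩
    rw [ribbonMaj, h.ribbonDes_eq]
    exact hf

end Ribbons

/-! ### Standard tuples of tableaux as permutations -/

section Tableaux

variable {k : ℕ} {μ : Fin k → SkewShape}

/-- The cells in the content reading order. -/
def readingEquiv (μ : Fin k → SkewShape) : Fin (size μ) ≃o Cell μ :=
  Fintype.orderIsoFinOfCardEq (Cell μ) rfl

theorem word_eq_ofFn (T : SYT μ) : T.word = List.ofFn fun p => T.entry (readingEquiv μ p) := by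
  have : (Finset.univ : Finset (Cell μ)).sort (· ≤ ·) = List.ofFn (readingEquiv μ) := by
    refine List.Perm.eq_of_pairwise' (r := (· ≤ ·)) ?_ ?_ ?_
    · exact Finset.pairwise_sort _ _
    · rw [List.pairwise_ofFn]
      intro i j hij
      exact ((readingEquiv μ).strictMono hij).le
    · rw [List.perm_ext_iff_of_nodup (Finset.sort_nodup _ _)
        (List.nodup_ofFn.2 (readingEquiv μ).injective)]
      intro x
      simpa using (readingEquiv μ).surjective x
  rw [SYT.word, this, List.map_ofFn]
  rfl

/-- The entries of a tableau, counted from `0`. -/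
def entryEquiv (T : SYT μ) : Cell μ ≃ Fin (size μ) :=
  Equiv.ofBijective (fun x => ⟨T.entry x - 1, by
      have := T.bijOn.mapsTo (Set.mem_univ x)
      rw [Set.mem_Icc] at this
      omega⟩) (by
    constructor
    · intro x y h
      have hx := T.bijOn.mapsTo (Set.mem_univ x)
      have hy := T.bijOn.mapsTo (Set.mem_univ y)
      rw [Set.mem_Icc] at hx hy
      rw [Fin.mk.injEq] at h
      exact T.bijOn.injOn (Set.mem_univ x) (Set.mem_univ y) (by omega)
    · intro i
      obtain ⟨x, -, hx⟩ := T.bijOn.surjOn (Set.mem_Icc.2 ⟨Nat.succ_le_succ (Nat.zero_le i), i.2⟩)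
      exact ⟨x, Fin.ext (by simp [hx])⟩)

theorem entry_eq (T : SYT μ) (x : Cell μ) : T.entry x = entryEquiv T x + 1 := by
  have := T.bijOn.mapsTo (Set.mem_univ x)
  rw [Set.mem_Icc] at this
  have h : (entryEquiv T x : ℕ) = T.entry x - 1 := rfl
  omega

theorem entry_injective (T : SYT μ) : Function.Injective T.entry :=
  Set.injOn_univ.1 T.bijOn.injOn

/-- The inverse of the content reading word, as a permutation: it maps an entry to the position of
its cell in the content reading order. -/
def positionPerm (T : SYT μ) : Equiv.Perm (Fin (size μ)) :=
  (entryEquiv T).symm.trans (readingEquiv μ).symm.toEquiv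

theorem positionPerm_symm_apply (T : SYT μ) (p : Fin (size μ)) :
    (positionPerm T).symm p = entryEquiv T (readingEquiv μ p) := rfl

theorem positionPerm_injective : Function.Injective (positionPerm (μ := μ)) := by
  intro T T' h
  ext x
  have h1 := positionPerm_symm_apply T ((readingEquiv μ).symm x)
  have h2 := positionPerm_symm_apply T' ((readingEquiv μ).symm x)
  rw [OrderIso.apply_symm_apply] at h1 h2
  rw [entry_eq, entry_eq, ← h1, ← h2, h]

theorem nodup_word (T : SYT μ) : T.word.Nodup := by
  rw [word_eq_ofFn]
  exact List.nodup_ofFn.2 ((entry_injective T).comp (readingEquiv μ).injective)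

theorem mem_word (T : SYT μ) {a : ℕ} : a ∈ T.word ↔ a ∈ Set.Icc 1 (size μ) := by
  rw [word_eq_ofFn, List.mem_ofFn]
  constructor
  · rintro ⟨p, rfl⟩
    exact T.bijOn.mapsTo (Set.mem_univ _)
  · intro h
    obtain ⟨x, -, hx⟩ := T.bijOn.surjOn h
    exact ⟨(readingEquiv μ).symm x, by simp [hx]⟩

theorem idxOf_entry (T : SYT μ) (x : Cell μ) :
    T.word.idxOf (T.entry x) = (readingEquiv μ).symm x := by
  have hlen : T.word.length = size μ := by rw [word_eq_ofFn, List.length_ofFn]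
  have h := (nodup_word T).idxOf_getElem ((readingEquiv μ).symm x) (by omega)
  have h2 : T.word[((readingEquiv μ).symm x : ℕ)]'(by omega) = T.entry x := by
    simp [word_eq_ofFn]
  rwa [h2] at h

theorem idxOf_word (T : SYT μ) (i : Fin (size μ)) :
    T.word.idxOf ((i : ℕ) + 1) = positionPerm T i := by
  have := idxOf_entry T ((entryEquiv T).symm i)
  rw [entry_eq, Equiv.apply_symm_apply] at this
  exact this

theorem idxOf_entry_lt_iff (T : SYT μ) (x y : Cell μ) :
    T.word.idxOf (T.entry x) < T.word.idxOf (T.entry y) ↔ x < y := by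
  rw [idxOf_entry, idxOf_entry, Fin.val_fin_lt, OrderIso.lt_iff_lt]

/-! ### Descents and inversions of a tableau in terms of its permutation -/

theorem signatureDes_word (T : SYT μ) :
    signatureDes (size μ) T.word = descents (positionPerm T) := by
  ext i
  rw [signatureDes, Finset.mem_filter, Finset.mem_Icc, mem_descents]
  constructor
  · rintro ⟨⟨h1, h2⟩, h3⟩
    have hi : i < size μ := by omega
    refine ⟨h1, hi, ?_⟩
    have e1 := idxOf_word T ⟨i, hi⟩
    have e2 := idxOf_word T ⟨i - 1, by omega⟩
    simp only [Nat.sub_add_cancel h1] at e1 e2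
    rw [Fin.lt_def, ← e1, ← e2]
    exact h3
  · rintro ⟨h1, hi, h3⟩
    refine ⟨⟨h1, by omega⟩, ?_⟩
    have e1 := idxOf_word T ⟨i, hi⟩
    have e2 := idxOf_word T ⟨i - 1, by omega⟩
    simp only [Nat.sub_add_cancel h1] at e1 e2
    rw [e1, e2]
    exact h3

/-- The reading word and its inverse have equally many inversions: exchange positions and values. -/
theorem winv_eq_inversions (T : SYT μ) : T.winv = inversions (List.ofFn (positionPerm T)) := by
  rw [inversions_ofFn, SYT.winv, ← Set.ncard_coe_finset]
  refine Set.ncard_congr (fun p _ => (entryEquiv T p.2, entryEquiv T p.1)) ?_ ?_ ?_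
  · rintro ⟨x, y⟩ ⟨h1, h2⟩
    simp only [entry_eq] at h2
    simp only [Finset.coe_filter, Finset.mem_univ, true_and, Set.mem_ofPred_eq]
    refine ⟨by rw [Fin.lt_def]; omega, ?_⟩
    simpa [positionPerm] using h1
  · rintro ⟨x, y⟩ ⟨x', y'⟩ _ _ h
    simpa [and_comm] using h
  · rintro ⟨a, b⟩ h
    simp only [Finset.coe_filter, Finset.mem_univ, true_and, Set.mem_ofPred_eq] at h
    refine ⟨((entryEquiv T).symm b, (entryEquiv T).symm a), ⟨?_, ?_⟩, by simp⟩
    · simpa [positionPerm] using h.2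
    · simp only [entry_eq, Equiv.apply_symm_apply]
      have := Fin.lt_def.1 h.1
      omega

theorem firstLastMem_wordInv (hn : 0 < size μ) (T : SYT μ) :
    FirstLastMem T.wordInv ↔
      (positionPerm T).symm ⟨size μ - 1, by omega⟩ < (positionPerm T).symm ⟨0, hn⟩ := by
  have hbot : IsBot (readingEquiv μ ⟨0, hn⟩) := by
    intro x
    rw [← OrderIso.le_symm_apply, Fin.le_def]
    exact Nat.zero_le _
  have htop : IsTop (readingEquiv μ ⟨size μ - 1, by omega⟩) := by
    intro x
    rw [← OrderIso.symm_apply_le, Fin.le_def]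
    have := ((readingEquiv μ).symm x).2
    simp only
    omega
  rw [positionPerm_symm_apply, positionPerm_symm_apply]
  constructor
  · rintro ⟨x, y, hx, hy, -, hlt⟩
    rw [le_antisymm (hx _) (hbot x), le_antisymm (htop y) (hy _)] at hlt
    simp only [entry_eq] at hlt
    rw [Fin.lt_def]
    omega
  · intro h
    refine ⟨_, _, hbot, htop, lt_of_le_of_ne (hbot _) ?_, ?_⟩
    · intro he
      exact h.ne (congrArg _ he.symm)
    · simp only [entry_eq]
      have := Fin.lt_def.1 h
      omega

theorem pair_sublist_ofFn_iff {n : ℕ} (σ : Equiv.Perm (Fin n)) (a b : Fin n) :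
    [a, b].Sublist (List.ofFn σ) ↔ σ.symm a < σ.symm b := by
  have hnd : (List.ofFn σ).Nodup := List.nodup_ofFn.2 σ.injective
  have key : ∀ a b, σ.symm a < σ.symm b → [a, b].Sublist (List.ofFn σ) := by
    intro a b h
    rw [List.cons_sublist_iff]
    refine ⟨(List.ofFn σ).take (σ.symm b), (List.ofFn σ).drop (σ.symm b),
      (List.take_append_drop _ _).symm, ?_, ?_⟩
    · rw [List.mem_take_iff_getElem]
      exact ⟨σ.symm a, by simpa using h, by simp⟩
    · rw [List.singleton_sublist, List.mem_drop_iff_getElem]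
      exact ⟨0, by simp, by simp⟩
  refine ⟨fun h => ?_, key a b⟩
  by_contra hcon
  rcases (not_lt.1 hcon).eq_or_lt with he | hlt
  · have := h.nodup hnd
    rw [σ.symm.injective he] at this
    simp at this
  · exact not_pair_sublist hnd h (key b a hlt)

/-! ### Existence of twisted moves -/

theorem Cell.shiftedContent_eq (x : Cell μ) :
    x.shiftedContent = k * ((x.col : ℤ) - x.row) + (x.idx : ℕ) := rfl

theorem Cell.eq_of_shiftedContent_eq {x y : Cell μ} (h : x.shiftedContent = y.shiftedContent) :
    x.idx = y.idx ∧ (x.col : ℤ) - x.row = y.col - y.row := by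
  have hi : ((x.idx : ℕ) : ℤ) < k := by exact_mod_cast x.idx.2
  have hj : ((y.idx : ℕ) : ℤ) < k := by exact_mod_cast y.idx.2
  have hk : (0 : ℤ) < k := by omega
  rw [Cell.shiftedContent_eq, Cell.shiftedContent_eq] at h
  have e : (x.col : ℤ) - x.row = y.col - y.row := by
    have e1 := Int.mul_add_ediv_left ((x.col : ℤ) - x.row) (x.idx : ℕ) hk.ne'
    have e2 := Int.mul_add_ediv_left ((y.col : ℤ) - y.row) (y.idx : ℕ) hk.ne'
    rw [Int.ediv_eq_zero_of_lt (by positivity) hi] at e1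
    rw [Int.ediv_eq_zero_of_lt (by positivity) hj, ← h, e1] at e2
    omega
  rw [e] at h
  exact ⟨Fin.ext (by omega), e⟩

/-- Applied to two cells of one row or of one column. If their entries lie within a window
satisfying `DistLE`, the distance must be exactly `k`, which is what makes `DistLE.between`
applicable. -/
theorem Cell.le_sub_shiftedContent {x y : Cell μ} (hidx : x.idx = y.idx)
    (h : (x.col : ℤ) - x.row < y.col - y.row) :
    (k : ℤ) ≤ y.shiftedContent - x.shiftedContent := by
  rw [Cell.shiftedContent_eq, Cell.shiftedContent_eq, hidx]
  have : (k : ℤ) * ((x.col : ℤ) - x.row + 1) ≤ k * ((y.col : ℤ) - y.row) :=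
    mul_le_mul_of_nonneg_left (by omega) (by positivity)
  linarith

theorem SYT.entry_lt_of_le (T : SYT μ) {x y : Cell μ} (hidx : x.idx = y.idx) (hr : x.row ≤ y.row)
    (hc : x.col ≤ y.col) (hne : x ≠ y) : T.entry x < T.entry y := by
  obtain ⟨⟨i, r, c⟩, hx⟩ := x
  obtain ⟨⟨j, r', c'⟩, hy⟩ := y
  obtain rfl : i = j := hidx
  change r ≤ r' at hr
  change c ≤ c' at hc
  let w : Cell μ := ⟨(i, r, c'), (μ i).mem_cells_of_le_of_le hx hy
    (Prod.mk_le_mk.2 ⟨le_rfl, hc⟩) (Prod.mk_le_mk.2 ⟨hr, le_rfl⟩)⟩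
  rcases hr.eq_or_lt with rfl | hr
  · rcases hc.eq_or_lt with rfl | hc
    · exact absurd rfl hne
    · exact T.row_lt _ _ rfl rfl hc
  · have h2 : T.entry w < T.entry ⟨(i, r', c'), hy⟩ := T.col_lt _ _ rfl rfl hr
    rcases hc.eq_or_lt with rfl | hc
    · exact h2
    · exact (T.row_lt ⟨(i, r, c), hx⟩ w rfl rfl hc).trans h2

/-- Entries on the same diagonal differ by at least three. -/
theorem SYT.add_three_le_of_shiftedContent_eq (T : SYT μ) {x y : Cell μ}
    (h : x.shiftedContent = y.shiftedContent) (hr : x.row < y.row) :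
    T.entry x + 3 ≤ T.entry y := by
  obtain ⟨hidx, hcont⟩ := Cell.eq_of_shiftedContent_eq h
  obtain ⟨⟨i, r, c⟩, hx⟩ := x
  obtain ⟨⟨j, r', c'⟩, hy⟩ := y
  obtain rfl : i = j := hidx
  change r < r' at hr
  change (c : ℤ) - r = c' - r' at hcont
  have hc : c < c' := by omega
  let u : Cell μ := ⟨(i, r, c + 1), (μ i).mem_cells_of_le_of_le hx hy
    (Prod.mk_le_mk.2 ⟨le_rfl, by omega⟩) (Prod.mk_le_mk.2 ⟨by omega, by omega⟩)⟩
  let v : Cell μ := ⟨(i, r + 1, c), (μ i).mem_cells_of_le_of_le hx hy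
    (Prod.mk_le_mk.2 ⟨by omega, le_rfl⟩) (Prod.mk_le_mk.2 ⟨by omega, by omega⟩)⟩
  have h1 : T.entry ⟨(i, r, c), hx⟩ < T.entry u := T.row_lt _ u rfl rfl (Nat.lt_succ_self c)
  have h2 : T.entry ⟨(i, r, c), hx⟩ < T.entry v := T.col_lt _ v rfl rfl (Nat.lt_succ_self r)
  have h3 : T.entry u < T.entry ⟨(i, r', c'), hy⟩ := by
    refine T.entry_lt_of_le rfl (show r ≤ r' by omega) (show c + 1 ≤ c' by omega) fun he => ?_
    have : r = r' := congrArg Cell.row he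
    omega
  have h4 : T.entry v < T.entry ⟨(i, r', c'), hy⟩ := by
    refine T.entry_lt_of_le rfl (show r + 1 ≤ r' by omega) (show c ≤ c' by omega) fun he => ?_
    have : c = c' := congrArg Cell.col he
    omega
  have h5 : T.entry u ≠ T.entry v := fun he => by
    have : r = r + 1 := congrArg Cell.row (entry_injective T he)
    omega
  omega

theorem SYT.shiftedContent_ne (T : SYT μ) {x y : Cell μ} (hne : T.entry x ≠ T.entry y)
    (h1 : T.entry x ≤ T.entry y + 2) (h2 : T.entry y ≤ T.entry x + 2) :
    x.shiftedContent ≠ y.shiftedContent := by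
  intro h
  rcases lt_trichotomy x.row y.row with hr | hr | hr
  · have := T.add_three_le_of_shiftedContent_eq h hr
    omega
  · have : x = y := Cell.readingKey_injective (by simp [Cell.readingKey, h, hr])
    exact hne (congrArg _ this)
  · have := T.add_three_le_of_shiftedContent_eq h.symm hr
    omega

theorem Cell.lt_of_shiftedContent_lt {x y : Cell μ} (h : x.shiftedContent < y.shiftedContent) :
    x < y := by
  change x.readingKey < y.readingKey
  exact Prod.Lex.toLex_lt_toLex.2 (.inl h)

/-- If `i - 1`, `i`, `i + 1` lie close to each other, and two of them are so far apart that their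
cells may be comparable, then the third one is read between them. -/
theorem DistLE.between {i : ℕ} {T : SYT μ} (hd : DistLE i T) {x y z : Cell μ}
    (hx : T.entry x ∈ ({i - 1, i, i + 1} : Set ℕ)) (hy : T.entry y ∈ ({i - 1, i, i + 1} : Set ℕ))
    (hz : T.entry z ∈ ({i - 1, i, i + 1} : Set ℕ)) (hzx : T.entry z ≠ T.entry x)
    (hzy : T.entry z ≠ T.entry y) (h : (k : ℤ) ≤ y.shiftedContent - x.shiftedContent) :
    x < z ∧ z < y := by
  have h1 := hd x y hx hy
  have h2 := hd x z hx hz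
  have h3 := hd z y hz hy
  simp only [Set.mem_insert_iff, Set.mem_singleton_iff] at hx hy hz
  have h4 := T.shiftedContent_ne hzx (by omega) (by omega)
  have h5 := T.shiftedContent_ne hzy (by omega) (by omega)
  exact ⟨Cell.lt_of_shiftedContent_lt (by omega), Cell.lt_of_shiftedContent_lt (by omega)⟩

/-- The rotation of the letters `i - 1`, `i`, `i + 1` in the definition of `twistedMove`. -/
def twist (i : ℕ) (w : List ℕ) (a : ℕ) : ℕ :=
  if a = i then nearer i w
  else if a = nearer i w then farther i w
  else if a = farther i w then i
  else a

theorem twistedMove_of_not_liesBetween {i : ℕ} {w : List ℕ} (h : ¬ LiesBetween i w) :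
    twistedMove i w = w.map (twist i w) := by
  rw [twistedMove, if_neg h]
  rfl

theorem nearer_farther (i : ℕ) (w : List ℕ) :
    Nat.dist (w.idxOf i) (w.idxOf (i + 1)) < Nat.dist (w.idxOf i) (w.idxOf (i - 1)) ∧
      nearer i w = i + 1 ∧ farther i w = i - 1 ∨
    ¬ Nat.dist (w.idxOf i) (w.idxOf (i + 1)) < Nat.dist (w.idxOf i) (w.idxOf (i - 1)) ∧
      nearer i w = i - 1 ∧ farther i w = i + 1 := by
  unfold nearer farther
  split_ifs with h
  · exact .inl ⟨h, rfl, rfl⟩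
  · exact .inr ⟨h, rfl, rfl⟩

theorem twist_injective {i : ℕ} (hi : 1 < i) (w : List ℕ) : Function.Injective (twist i w) := by
  intro a b h
  unfold twist at h
  rcases nearer_farther i w with ⟨-, h1, h2⟩ | ⟨-, h1, h2⟩ <;> rw [h1, h2] at h <;>
    split_ifs at h <;> omega

theorem bijOn_twist {i n : ℕ} (hi : 1 < i) (hin : i < n) (w : List ℕ) :
    Set.BijOn (twist i w) (Set.Icc 1 n) (Set.Icc 1 n) := by
  have hm : Set.MapsTo (twist i w) (Set.Icc 1 n) (Set.Icc 1 n) := by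
    intro a ha
    rw [Set.mem_Icc] at ha ⊢
    unfold twist
    rcases nearer_farther i w with ⟨-, h1, h2⟩ | ⟨-, h1, h2⟩ <;> rw [h1, h2] <;>
      split_ifs <;> omega
  refine ⟨hm, (twist_injective hi w).injOn, ?_⟩
  have himg : twist i w '' Set.Icc 1 n = Set.Icc 1 n :=
    Set.eq_of_subset_of_ncard_le hm.image_subset
      (Set.ncard_image_of_injective _ (twist_injective hi w)).ge (Set.finite_Icc 1 n)
  exact himg.ge

/-- The rotation permutes only the window i - 1, i, i + 1, so it cannot change the order of two
letters unless both are in the window. -/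
theorem twist_lt_twist {i : ℕ} (hi : 1 < i) {w : List ℕ} {a b : ℕ} (hab : a < b)
    (h : ¬ (i - 1 ≤ a ∧ b ≤ i + 1)) : twist i w a < twist i w b := by
  unfold twist
  rcases nearer_farther i w with ⟨-, h1, h2⟩ | ⟨-, h1, h2⟩ <;> rw [h1, h2] <;>
    split_ifs <;> omega

theorem SYT.exists_cell (T : SYT μ) {a : ℕ} (h1 : 1 ≤ a) (h2 : a ≤ size μ) :
    ∃ x, T.entry x = a := by
  obtain ⟨x, -, hx⟩ := T.bijOn.surjOn (Set.mem_Icc.2 ⟨h1, h2⟩)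
  exact ⟨x, hx⟩

/-- Twisting does not change the order of two letters if the third letter is placed between them. -/
theorem twist_lt_twist_of_between {i : ℕ} (hi : 1 < i) (hin : i < size μ) {T : SYT μ}
    (hL : ¬ LiesBetween i T.word) {x y : Cell μ} (hxy : T.entry x < T.entry y)
    (h1 : i - 1 ≤ T.entry x) (h2 : T.entry y ≤ i + 1)
    (h : ∀ z, T.entry z ∈ ({i - 1, i, i + 1} : Set ℕ) → T.entry z ≠ T.entry x →
      T.entry z ≠ T.entry y → (x < z ∧ z < y) ∨ (y < z ∧ z < x)) :
    twist i T.word (T.entry x) < twist i T.word (T.entry y) := by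
  obtain ⟨z, hz, hzx, hzy⟩ : ∃ z, T.entry z ∈ ({i - 1, i, i + 1} : Set ℕ) ∧
      T.entry z ≠ T.entry x ∧ T.entry z ≠ T.entry y := by
    -- The three letters of the window add up to `3 * i`, so this is the third one.
    obtain ⟨z, hz⟩ := T.exists_cell (a := 3 * i - T.entry x - T.entry y) (by omega) (by omega)
    refine ⟨z, ?_, ?_, ?_⟩
    · simp only [Set.mem_insert_iff, Set.mem_singleton_iff]
      omega
    · omega
    · omega
  have hb := h z hz hzx hzy
  simp only [← idxOf_entry_lt_iff T] at hb
  simp only [Set.mem_insert_iff, Set.mem_singleton_iff] at hz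
  unfold LiesBetween at hL
  have hcases : (T.entry x = i - 1 ∧ T.entry y = i ∧ T.entry z = i + 1) ∨
      (T.entry x = i ∧ T.entry y = i + 1 ∧ T.entry z = i - 1) ∨
      (T.entry x = i - 1 ∧ T.entry y = i + 1 ∧ T.entry z = i) := by omega
  have hnf := nearer_farther i T.word
  -- If the third letter is i + 1 or i - 1, being placed between the two others makes it the
  -- neighbour nearer to i, which determines the rotation. If it is i, then `LiesBetween` would
  -- hold.
  rcases hcases with ⟨e1, e2, e3⟩ | ⟨e1, e2, e3⟩ | ⟨e1, e2, e3⟩ <;> rw [e1, e2, e3] at hb <;>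
    rw [e1, e2] <;> unfold Nat.dist at hnf <;> unfold twist
  · obtain ⟨-, h1, h2⟩ := hnf.resolve_right (by omega)
    rw [h1, h2]
    split_ifs <;> omega
  · obtain ⟨-, h1, h2⟩ := hnf.resolve_left (by omega)
    rw [h1, h2]
    split_ifs <;> omega
  · exact absurd hb hL

theorem SYT.entry_mem_of_le_of_le (T : SYT μ) {i : ℕ} {x : Cell μ} (h1 : i - 1 ≤ T.entry x)
    (h2 : T.entry x ≤ i + 1) : T.entry x ∈ ({i - 1, i, i + 1} : Set ℕ) := by
  simp only [Set.mem_insert_iff, Set.mem_singleton_iff]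
  omega

/-- If the entries `i - 1`, `i`, `i + 1` lie close to each other, the twisted move is a move of
tableaux. -/
theorem exists_word_eq_twistedMove {i : ℕ} (hi : 1 < i) (hin : i < size μ) {T : SYT μ}
    (hd : DistLE i T) : ∃ T' : SYT μ, T'.word = twistedMove i T.word := by
  by_cases hL : LiesBetween i T.word
  · exact ⟨T, by rw [twistedMove, if_pos hL]⟩
  refine ⟨⟨fun x => twist i T.word (T.entry x), (bijOn_twist hi hin T.word).comp T.bijOn, ?_, ?_⟩,
    ?_⟩
  · intro x y hidx hrow hcol
    have hlt := T.row_lt x y hidx hrow hcol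
    by_cases hw : i - 1 ≤ T.entry x ∧ T.entry y ≤ i + 1
    · refine twist_lt_twist_of_between hi hin hL hlt hw.1 hw.2 fun z hz hzx hzy => .inl ?_
      refine hd.between (T.entry_mem_of_le_of_le hw.1 (by omega))
        (T.entry_mem_of_le_of_le (by omega) hw.2) hz hzx hzy
        (Cell.le_sub_shiftedContent hidx (by omega))
    · exact twist_lt_twist hi hlt hw
  · intro x y hidx hcol hrow
    have hlt := T.col_lt x y hidx hcol hrow
    by_cases hw : i - 1 ≤ T.entry x ∧ T.entry y ≤ i + 1
    · refine twist_lt_twist_of_between hi hin hL hlt hw.1 hw.2 fun z hz hzx hzy => .inr ?_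
      refine hd.between (T.entry_mem_of_le_of_le (by omega) hw.2)
        (T.entry_mem_of_le_of_le hw.1 (by omega)) hz hzy hzx
        (Cell.le_sub_shiftedContent hidx.symm (by omega))
    · exact twist_lt_twist hi hlt hw
  · rw [twistedMove_of_not_liesBetween hL]
    unfold SYT.word
    rw [List.map_map]
    rfl

/-- The two kinds of moves agree only where both are trivial: otherwise `dualMove` replaces i by the
farther neighbour and `twistedMove` by the nearer one. So the hypothesis forces `LiesBetween` or
`DistLE`, and in both cases the new word belongs to a tableau. -/
theorem exists_word_eq_moveWord {i : ℕ} (hi : 1 < i) (hin : i < size μ) {T : SYT μ}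
    (h : moveWord i T = twistedMove i T.word) : ∃ T' : SYT μ, T'.word = moveWord i T := by
  rw [h]
  by_cases hd : DistLE i T
  · exact exists_word_eq_twistedMove hi hin hd
  by_cases hL : LiesBetween i T.word
  · exact ⟨T, by rw [twistedMove, if_pos hL]⟩
  rw [moveWord, if_neg hd, twistedMove_of_not_liesBetween hL, dualMove, if_neg hL,
    List.map_inj_left] at h
  have := h i ((mem_word T).2 (Set.mem_Icc.2 ⟨by omega, by omega⟩))
  simp only [twist, if_true] at this
  rcases nearer_farther i T.word with ⟨-, h1, h2⟩ | ⟨-, h1, h2⟩ <;> rw [h1, h2] at this <;> omega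

end Tableaux

/-! ### Twisted moves as forgotten steps -/

section Classes

variable {k : ℕ} {μ : Fin k → SkewShape}

/-- Bookkeeping for a local move: reads off three consecutive values of `σ`, and describes the list
of any `σ'` that agrees with `σ` outside these places. -/
theorem ofFn_eq_append_of_swap {n : ℕ} {α : Type*} {σ σ' : Fin n → α} {x y : List α} {p q r : α}
    (h : List.ofFn σ = x ++ p :: q :: r :: y) :
    ∃ hlt : x.length + 2 < n, σ ⟨x.length, by omega⟩ = p ∧ σ ⟨x.length + 1, by omega⟩ = q ∧
      σ ⟨x.length + 2, hlt⟩ = r ∧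
      ((∀ i : Fin n, (i : ℕ) < x.length ∨ x.length + 2 < i → σ' i = σ i) →
        List.ofFn σ' = x ++ σ' ⟨x.length, by omega⟩ :: σ' ⟨x.length + 1, by omega⟩ ::
          σ' ⟨x.length + 2, hlt⟩ :: y) := by
  have hlen := congrArg List.length h
  simp only [List.length_ofFn, List.length_append, List.length_cons] at hlen
  have hget : ∀ (i : ℕ) (hi : i < n), σ ⟨i, hi⟩ = (x ++ p :: q :: r :: y)[i]'(by
      simp; omega) := by
    intro i hi
    simp [← h]
  refine ⟨by omega, ?_, ?_, ?_, ?_⟩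
  · rw [hget]
    simp
  · rw [hget, List.getElem_append_right (by omega)]
    simp
  · rw [hget, List.getElem_append_right (by omega)]
    simp
  · intro hσ
    apply List.ext_getElem
    · simp
      omega
    · intro i h1 h2
      rw [List.length_ofFn] at h1
      rw [List.getElem_ofFn]
      by_cases hi : i < x.length
      · rw [List.getElem_append_left hi, hσ ⟨i, h1⟩ (.inl hi), hget, List.getElem_append_left hi]
      · rw [List.getElem_append_right (by omega)]
        obtain ⟨j, rfl⟩ : ∃ j, i = x.length + j := ⟨i - x.length, by omega⟩
        match j with
        | 0 => simp
        | 1 => simp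
        | 2 => simp
        | j + 3 =>
          rw [hσ ⟨x.length + (j + 3), h1⟩ (.inr (by simp only; omega)), hget,
            List.getElem_append_right (by omega)]
          simp

theorem idxOf_map_of_injective {f : ℕ → ℕ} (hf : Function.Injective f) (l : List ℕ) (a : ℕ) :
    (l.map f).idxOf (f a) = l.idxOf a := by
  induction l with
  | nil => simp
  | cons b l ih =>
    rw [List.map_cons, List.idxOf_cons, List.idxOf_cons, ih]
    have : (f b == f a) = (b == a) := by
      rw [Bool.eq_iff_iff]
      simp [hf.eq_iff]
    rw [this]

/-- A twisted move in terms of positions. -/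
theorem ofFn_positionPerm_of_twistedMove {T T' : SYT μ} {x y : List (Fin (size μ))}
    {p q r : Fin (size μ)} (h : List.ofFn (positionPerm T) = x ++ p :: q :: r :: y)
    (hT' : T'.word = twistedMove (x.length + 2) T.word) :
    (LiesBetween (x.length + 2) T.word ↔ p < q ∧ q < r ∨ r < q ∧ q < p) ∧
    ((p < r ∧ r < q ∨ q < r ∧ r < p) → List.ofFn (positionPerm T') = x ++ r :: p :: q :: y) ∧
    ((r < p ∧ p < q ∨ q < p ∧ p < r) → List.ofFn (positionPerm T') = x ++ q :: r :: p :: y) := by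
  obtain ⟨hlt, hp, hq, hr, hT⟩ :=
    ofFn_eq_append_of_swap (σ' := positionPerm T') h
  -- Positions in `List.ofFn` start at 0 and entries at 1, so `p`, `q`, `r` are the positions in the
  -- word of i - 1, i, i + 1 for i = `x.length + 2`.
  have ip := idxOf_word T ⟨x.length, by omega⟩
  have iq := idxOf_word T ⟨x.length + 1, by omega⟩
  have ir := idxOf_word T ⟨x.length + 2, by omega⟩
  rw [hp] at ip
  rw [hq] at iq
  rw [hr] at ir
  simp only at ip iq ir
  have hb : LiesBetween (x.length + 2) T.word ↔ p < q ∧ q < r ∨ r < q ∧ q < p := by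
    unfold LiesBetween
    simp only [Fin.lt_def]
    rw [show x.length + 2 - 1 = x.length + 1 from rfl, ip, iq, ir]
  -- The move relabels letters without moving places, so the new letter `twist a` stands where `a`
  -- stood.
  have hpos : ¬ LiesBetween (x.length + 2) T.word → ∀ i j : Fin (size μ),
      twist (x.length + 2) T.word (i + 1) = j + 1 → positionPerm T' j = positionPerm T i := by
    intro hL i j hij
    have := idxOf_word T' j
    rw [hT', twistedMove_of_not_liesBetween hL, ← hij,
      idxOf_map_of_injective (twist_injective (by omega) _), idxOf_word] at this
    exact Fin.ext this.symm
  have hnf := nearer_farther (x.length + 2) T.word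
  rw [show x.length + 2 - 1 = x.length + 1 from rfl, ip, iq, ir] at hnf
  unfold Nat.dist at hnf
  have hout : ¬ LiesBetween (x.length + 2) T.word → ∀ i : Fin (size μ),
      (i : ℕ) < x.length ∨ x.length + 2 < i → positionPerm T' i = positionPerm T i := by
    intro hL i hi
    refine hpos hL i i ?_
    unfold twist
    rcases hnf with ⟨-, h1, h2⟩ | ⟨-, h1, h2⟩ <;> rw [h1, h2] <;> split_ifs <;> omega
  refine ⟨hb, fun hc => ?_, fun hc => ?_⟩
  · have hL : ¬ LiesBetween (x.length + 2) T.word := by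
      rw [hb]
      simp only [Fin.lt_def] at hc ⊢
      omega
    simp only [Fin.lt_def] at hc
    obtain ⟨-, h1, h2⟩ := hnf.resolve_right (by omega)
    rw [hT (hout hL), hpos hL ⟨x.length + 2, hlt⟩ ⟨x.length, by omega⟩ (by simp [twist, h1, h2]),
      hpos hL ⟨x.length, by omega⟩ ⟨x.length + 1, by omega⟩ (by simp [twist, h1, h2]),
      hpos hL ⟨x.length + 1, by omega⟩ ⟨x.length + 2, hlt⟩ (by simp [twist, h1]),
      hp, hq, hr]
  · have hL : ¬ LiesBetween (x.length + 2) T.word := by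
      rw [hb]
      simp only [Fin.lt_def] at hc ⊢
      omega
    simp only [Fin.lt_def] at hc
    obtain ⟨-, h1, h2⟩ := hnf.resolve_left (by omega)
    rw [hT (hout hL), hpos hL ⟨x.length + 1, by omega⟩ ⟨x.length, by omega⟩
        (by simp [twist, h1]),
      hpos hL ⟨x.length + 2, by omega⟩ ⟨x.length + 1, by omega⟩ (by simp [twist, h1, h2]),
      hpos hL ⟨x.length, by omega⟩ ⟨x.length + 2, hlt⟩ (by simp [twist, h1, h2]),
      hp, hq, hr]

/-- All moves at `T` are twisted. -/
def MovesTwisted (T : SYT μ) : Prop :=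
  ∀ i : ℕ, 1 < i → i < size μ → moveWord i T = twistedMove i T.word

/-- A jump applied to the permutation of `T` at the places i - 1, i, i + 1 is the twisted move at i,
whose result is a tableau. Thus no forgotten step leaves the set of tableaux. -/
theorem MovesTwisted.exists_step {T : SYT μ} (hT : MovesTwisted T) {l : List (Fin (size μ))}
    (h : ForgottenStep (List.ofFn (positionPerm T)) l) :
    ∃ T', Step T T' ∧ List.ofFn (positionPerm T') = l := by
  have key : ∀ {x y : List (Fin (size μ))} {p q r : Fin (size μ)},
      List.ofFn (positionPerm T) = x ++ p :: q :: r :: y → ∃ T', Step T T' ∧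
      ((p < r ∧ r < q ∨ q < r ∧ r < p) → List.ofFn (positionPerm T') = x ++ r :: p :: q :: y) ∧
      ((r < p ∧ p < q ∨ q < p ∧ p < r) → List.ofFn (positionPerm T') = x ++ q :: r :: p :: y) := by
    intro x y p q r hl
    have hlen := congrArg List.length hl
    simp only [List.length_ofFn, List.length_append, List.length_cons] at hlen
    have hi : x.length + 2 < size μ := by omega
    obtain ⟨T', hT'⟩ := exists_word_eq_moveWord (by omega) hi (hT _ (by omega) hi)
    refine ⟨T', ⟨_, by omega, hi, hT'⟩, ?_⟩
    rw [hT _ (by omega) hi] at hT'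
    exact (ofFn_positionPerm_of_twistedMove hl hT').2
  generalize hl : List.ofFn (positionPerm T) = l₀ at h
  cases h with
  | right_lt_gt x y hab hbc =>
    obtain ⟨T', h1, h2, h3⟩ := key hl
    exact ⟨T', h1, h3 (.inr ⟨hab, hbc⟩)⟩
  | left_lt_gt x y hab hbc =>
    obtain ⟨T', h1, h2, h3⟩ := key hl
    exact ⟨T', h1, h2 (.inl ⟨hab, hbc⟩)⟩
  | right_gt_lt x y hab hbc =>
    obtain ⟨T', h1, h2, h3⟩ := key hl
    exact ⟨T', h1, h3 (.inl ⟨hab, hbc⟩)⟩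
  | left_gt_lt x y hab hbc =>
    obtain ⟨T', h1, h2, h3⟩ := key hl
    exact ⟨T', h1, h2 (.inr ⟨hab, hbc⟩)⟩

theorem MovesTwisted.forgotten_of_step {T T' : SYT μ} (hT : MovesTwisted T) (h : Step T T') :
    Forgotten (List.ofFn (positionPerm T)) (List.ofFn (positionPerm T')) := by
  obtain ⟨i, hi, hin, hw⟩ := h
  rw [hT i hi hin] at hw
  obtain ⟨x, p, q, r, y, hx, hl⟩ : ∃ x p q r y, x.length = i - 2 ∧
      List.ofFn (positionPerm T) = x ++ p :: q :: r :: y := by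
    set l := List.ofFn (positionPerm T) with hl
    have hlen : l.length = size μ := List.length_ofFn
    refine ⟨l.take (i - 2), l[i - 2], l[i - 2 + 1], l[i - 2 + 1 + 1], l.drop (i - 2 + 1 + 1 + 1),
      by simp; omega, ?_⟩
    rw [← List.drop_eq_getElem_cons, ← List.drop_eq_getElem_cons, ← List.drop_eq_getElem_cons,
      List.take_append_drop]
  obtain rfl : i = x.length + 2 := by omega
  obtain ⟨h1, h2, h3⟩ := ofFn_positionPerm_of_twistedMove hl hw
  by_cases hL : LiesBetween (x.length + 2) T.word
  · rw [twistedMove, if_pos hL] at hw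
    have : positionPerm T' = positionPerm T := by
      ext j
      rw [← idxOf_word, ← idxOf_word, hw]
    rw [this]
    exact Forgotten.refl _
  have hnd : (List.ofFn (positionPerm T)).Nodup := List.nodup_ofFn.2 (positionPerm T).injective
  rw [hl, List.nodup_append] at hnd
  have hnd := hnd.2.1
  simp only [List.nodup_cons, List.mem_cons, not_or] at hnd
  rw [h1] at hL
  -- Of the eight sign patterns two are contradictory and two have the median in the middle, which
  -- `hL` excludes. The other four are the four kinds of jumps.
  rcases lt_or_gt_of_ne hnd.1.1 with hpq | hpq <;> rcases lt_or_gt_of_ne hnd.2.1.1 with hqr | hqr <;>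
    rcases lt_or_gt_of_ne hnd.1.2.1 with hpr | hpr
  · exact absurd (.inl ⟨hpq, hqr⟩) hL
  · exact absurd (hpq.trans hqr) hpr.not_gt
  · rw [h2 (.inl ⟨hpr, hqr⟩), hl]
    exact (ForgottenStep.left_lt_gt x y hpr hqr).forgotten
  · rw [h3 (.inl ⟨hpr, hpq⟩), hl]
    exact (ForgottenStep.right_gt_lt x y hpr hpq).forgotten
  · rw [h3 (.inr ⟨hpq, hpr⟩), hl]
    exact (ForgottenStep.right_lt_gt x y hpq hpr).forgotten
  · rw [h2 (.inr ⟨hqr, hpr⟩), hl]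
    exact (ForgottenStep.left_gt_lt x y hqr hpr).forgotten
  · exact absurd (hqr.trans hpq) hpr.not_gt
  · exact absurd (.inr ⟨hqr, hpq⟩) hL

/-! ### The class of `U` as a forgotten class -/

theorem Equivalent.forgotten {U T : SYT μ} (hU : ∀ T, Equivalent U T → MovesTwisted T)
    (h : Equivalent U T) :
    Forgotten (List.ofFn (positionPerm U)) (List.ofFn (positionPerm T)) := by
  -- The generated equivalence may use steps backwards, so membership of the left endpoint in the
  -- class of `U` is carried through the induction; it gives access to `hU` at every step.
  have key : ∀ {x y : SYT μ}, Relation.EqvGen Step x y → Equivalent U x →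
      Forgotten (List.ofFn (positionPerm x)) (List.ofFn (positionPerm y)) := by
    intro x y hxy
    induction hxy with
    | rel x y h => exact fun hx => (hU x hx).forgotten_of_step h
    | refl x => exact fun _ => Forgotten.refl _
    | symm x y h ih => exact fun hy => (ih (hy.trans _ _ _ (h.symm _ _))).symm
    | trans x y z h1 h2 ih1 ih2 => exact fun hx => (ih1 hx).trans (ih2 (hx.trans _ _ _ h1))
  exact key h (Relation.EqvGen.refl U)

theorem exists_equivalent_of_forgotten {U : SYT μ} (hU : ∀ T, Equivalent U T → MovesTwisted T)
    {l : List (Fin (size μ))} (h : Forgotten (List.ofFn (positionPerm U)) l) :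
    ∃ T, Equivalent U T ∧ List.ofFn (positionPerm T) = l := by
  induction h with
  | refl => exact ⟨U, Relation.EqvGen.refl U, rfl⟩
  | tail _ h ih =>
    obtain ⟨T, hT, rfl⟩ := ih
    obtain ⟨T', h1, h2⟩ := (hU T hT).exists_step h
    exact ⟨T', hT.trans _ _ _ (Relation.EqvGen.rel _ _ h1), h2⟩

/-- Describes the permutations of the class by the two invariants. In the list of `σ` the letters 0
and `size μ - 1` stand for the first and the last cell read, so the pair (1,n) is an inversion
exactly when the largest letter comes before the smallest. -/
theorem exists_equivalent_iff (hn : 0 < size μ) {U : SYT μ}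
    (hU : ∀ T, Equivalent U T → MovesTwisted T) (σ : Equiv.Perm (Fin (size μ))) :
    (∃ T, Equivalent U T ∧ positionPerm T = σ) ↔
      inversions (List.ofFn σ) = U.winv ∧
        (σ.symm ⟨size μ - 1, by omega⟩ < σ.symm ⟨0, hn⟩ ↔ FirstLastMem U.wordInv) := by
  rw [winv_eq_inversions, firstLastMem_wordInv hn]
  set τ := positionPerm U
  set a : Fin (size μ) := ⟨0, hn⟩
  set b : Fin (size μ) := ⟨size μ - 1, by omega⟩
  have ha : ∀ z, a ≤ z := fun z => Fin.le_def.2 (Nat.zero_le _)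
  have hb : ∀ z, z ≤ b := fun z => Fin.le_def.2 (by have := z.2; simp only [b]; omega)
  -- The condition `a ≠ b` covers the case of a single cell, in which neither strict inequality
  -- holds.
  have hlt : ∀ ρ : Equiv.Perm (Fin (size μ)),
      ρ.symm a < ρ.symm b ↔ a ≠ b ∧ ¬ ρ.symm b < ρ.symm a := by
    intro ρ
    rw [not_lt, lt_iff_le_and_ne, and_comm, Ne, ρ.symm.injective.eq_iff]
  constructor
  · rintro ⟨T, hT, rfl⟩
    have hf := hT.forgotten hU
    refine ⟨hf.inversions_eq.symm, ?_⟩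
    have h1 := hf.pair_sublist_iff (m := a) (M := b) (fun z _ => ha z) (fun z _ => hb z)
    rw [pair_sublist_ofFn_iff, pair_sublist_ofFn_iff, hlt, hlt] at h1
    by_cases hab : a = b
    · rw [hab]
      simp
    · tauto
  · rintro ⟨h1, h2⟩
    have hc : SameClass a b (List.ofFn τ) (List.ofFn σ) :=
      { nodup := List.nodup_ofFn.2 τ.injective
        perm := by
          rw [List.perm_ext_iff_of_nodup (List.nodup_ofFn.2 τ.injective)
            (List.nodup_ofFn.2 σ.injective)]
          intro z
          simp only [List.mem_ofFn]
          exact ⟨fun _ => σ.surjective z, fun _ => τ.surjective z⟩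
        min_le := fun z _ => ha z
        le_max := fun z _ => hb z
        min_mem := List.mem_ofFn.2 (τ.surjective a)
        max_mem := List.mem_ofFn.2 (τ.surjective b)
        inversions_eq := h1.symm
        order := by rw [pair_sublist_ofFn_iff, pair_sublist_ofFn_iff, hlt, hlt, h2] }
    obtain ⟨T, hT, hl⟩ := exists_equivalent_of_forgotten hU hc.forgotten
    exact ⟨T, hT, DFunLike.coe_injective (List.ofFn_injective hl)⟩

/-- Coefficient by coefficient, both sides count words of a given weight: the ribbon side by major
index, the class side by inversions through standardization. Foata's theorem identifies the two
counts. -/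
theorem classSeries_eq_ribbonSum (hn : 0 < size μ) {U : SYT μ}
    (hU : ∀ T, Equivalent U T → MovesTwisted T) :
    classSeries U = ribbonSum (size μ) U.winv (FirstLastMem U.wordInv) := by
  classical
  funext m
  rw [ribbonSum_apply hn, ncard_maj_eq_ncard_inversions hn]
  set S := (Finset.univ.filter fun T : SYT μ => Equivalent U T).image positionPerm with hS
  rw [← sum_fundamental_descents_apply hn U.winv (FirstLastMem U.wordInv) S]
  · rw [hS, Finset.sum_image positionPerm_injective.injOn, classSeries]
    refine (map_sum (MvPowerSeries.coeff m) _ _).trans ?_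
    refine Finset.sum_congr (by congr) fun T _ => ?_
    rw [signatureDes_word]
    rfl
  · intro σ
    rw [← exists_equivalent_iff hn hU, hS, Finset.mem_image]
    simp

end Classes

end TwistedLLT

end

theorem mainTheorem9 {k : ℕ} (μ : Fin k → TwistedLLT.SkewShape) (hn : 0 < TwistedLLT.size μ)
    (U : TwistedLLT.SYT μ)
    (hU : ∀ T : TwistedLLT.SYT μ, TwistedLLT.Equivalent U T →
      ∀ i : ℕ, 1 < i → i < TwistedLLT.size μ →
        TwistedLLT.moveWord i T = TwistedLLT.twistedMove i T.word) :
    TwistedLLT.classSeries U =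
        TwistedLLT.ribbonSum (TwistedLLT.size μ) U.winv (TwistedLLT.FirstLastMem U.wordInv) ∧
      (U.dInv = U.wordInv →
        TwistedLLT.classSeries U =
          TwistedLLT.ribbonSum (TwistedLLT.size μ) U.dinv (TwistedLLT.FirstLastMem U.dInv)) := by
  have h := TwistedLLT.classSeries_eq_ribbonSum hn hU
  refine ⟨h, fun hd => ?_⟩
  rw [TwistedLLT.SYT.dinv, hd]
  exact h
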